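/- All graphs are finite, simple and undirected. A graph is \emph{quasi-threshold} if it has no induced $P_4$ and no induced $C_4$. A \emph{cactus} is a connected graph in which every edge lies in at most one cycle. A \emph{minimum deletion to cacti} of $G$ is a set $F\subseteq E(G)$ of minimum cardinality such that $(V(G),E(G)\setminus F)$ is a cactus; a \emph{maximum spanning cactus} of $G$ is a spanning subgraph of $G$ that is a cactus and has the maximum number of edges among all such subgraphs. A vertex is \emph{universal} if it is adjacent to all other vertices. \textbf{Theorem.} Let $G$ be a connected quasi-threshold graph. Then $G$ has a universal vertex. For every universal vertex $v$ of $G$, with $G_2=G-v$ (so that $G$ is the join $v\oplus G_2$): \begin{enumerate} \item $G_2$ is quasi-threshold, and $G$ has a maximum spanning cactus all of whose cycles are triangles through $v$; \item for every maximum matching $M$ of $G_2$, the graph with vertex set $V(G)$ and edge set $\{vw : w\in V(G)\setminus\{v\}\}\cup M$ is a maximum spanning cactus of $G$, and $E(G_2)\setminus M$ is a minimum deletion to cacti of $G$. \end{enumerate} Moreover, a minimum deletion to cacti can be computed in polynomial time: there are one program of a random access machine (with addition, truncated subtraction, indirect addressing and tests for zero, each at unit cost) and a polynomial $p$ such that on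 every connected quasi-threshold graph $G$ with vertex set $\{0,\dots,n-1\}$, given by $n$ and its adjacency matrix, the program halts after at most $p(n)$ steps and outputs (as a $0$-$1$ matrix) a minimum deletion to cacti $F$ of $G$; this $F$ is of the form $E(G-v)\setminus M$ for some universal vertex $v$ and some maximum matching $M$ of $G-v$. -/

import Mathlib

namespace CactusDeletion

/-! ### Graphs -/

/-- A graph is quasi-threshold if it is `{P₄, C₄}`-free, i.e. contains neither `P₄` nor `C₄` as an
induced subgraph. -/
def IsQuasiThreshold {V : Type*} (G : SimpleGraph V) : Prop :=
  ¬ (SimpleGraph.pathGraph 4).IsIndContained G ∧ ¬ (SimpleGraph.cycleGraph 4).IsIndContained G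

/-- The graph `G - v`. -/
abbrev minus {V : Type*} (G : SimpleGraph V) (v : V) : SimpleGraph {w : V // w ≠ v} :=
  G.induce {w : V | w ≠ v}

/-- A cactus: a connected graph in which every edge lies in at most one cycle. Cycles are
compared as subgraphs, so starting point and orientation of a closed walk do not matter. -/
def IsCactus {V : Type*} (H : SimpleGraph V) : Prop :=
  H.Connected ∧
    ∀ (a b : V) (p : H.Walk a a) (q : H.Walk b b), p.IsCycle → q.IsCycle →
      ∀ e, e ∈ p.edges → e ∈ q.edges → p.toSubgraph = q.toSubgraph

/-- `H` is a spanning cactus of `G` with the maximum number of edges. -/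
def IsMaxSpanningCactus {V : Type*} (G H : SimpleGraph V) : Prop :=
  H ≤ G ∧ IsCactus H ∧
    ∀ H' : SimpleGraph V, H' ≤ G → IsCactus H' → H'.edgeSet.ncard ≤ H.edgeSet.ncard

/-- `F` is a minimum deletion to cacti of `G`: a set of edges of `G`, of minimum cardinality, whose
removal leaves a cactus. (Used for finite graphs only.) -/
def IsMinCactusDeletion {V : Type*} (G : SimpleGraph V) (F : Set (Sym2 V)) : Prop :=
  F ⊆ G.edgeSet ∧ IsCactus (G.deleteEdges F) ∧
    ∀ F' : Set (Sym2 V), F' ⊆ G.edgeSet → IsCactus (G.deleteEdges F') → F.ncard ≤ F'.ncard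

/-- A matching with the maximum number of edges. (Used for finite graphs only.) -/
def IsMaxMatching {W : Type*} {G : SimpleGraph W} (M : G.Subgraph) : Prop :=
  M.IsMatching ∧ ∀ M' : G.Subgraph, M'.IsMatching → M'.edgeSet.ncard ≤ M.edgeSet.ncard

/-- For `M` a subgraph of `G - v`, the graph on `V` whose edges are the edges of `M` together with
all the pairs `{v, w}`, `w ≠ v`. -/
def starPlus {V : Type*} {G : SimpleGraph V} (v : V) (M : (minus G v).Subgraph) :
    SimpleGraph V where
  Adj a b := (a = v ∧ b ≠ v) ∨ (b = v ∧ a ≠ v) ∨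
    ∃ (ha : a ≠ v) (hb : b ≠ v), M.Adj ⟨a, ha⟩ ⟨b, hb⟩
  symm := ⟨by
    rintro a b (h | h | ⟨ha, hb, h⟩)
    · exact Or.inr (Or.inl h)
    · exact Or.inl h
    · exact Or.inr (Or.inr ⟨hb, ha, h.symm⟩)⟩
  loopless := ⟨by
    rintro a (⟨h, h'⟩ | ⟨h, h'⟩ | ⟨ha, hb, h⟩)
    · exact h' h
    · exact h' h
    · exact M.loopless.irrefl _ h⟩

/-! ### Random access machines

A RAM with registers `R₀, R₁, …` (a program mentions finitely many of them) and an indirectly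
addressed memory `M`. The only arithmetic is addition and truncated subtraction, at unit cost: in
`t` steps the bit length of the numbers grows by at most `t`, so that polynomial time on this
machine is the usual polynomial time. Programs are structured (while programs). -/

/-- Contents of the registers and of the memory. -/
structure State where
  reg : ℕ → ℕ
  mem : ℕ → ℕ

/-- `R_r := k`. -/
def State.setReg (s : State) (r k : ℕ) : State := { s with reg := Function.update s.reg r k }

/-- `M[a] := k`. -/
def State.setMem (s : State) (a k : ℕ) : State := { s with mem := Function.update s.mem a k }

/-- RAM programs; the meaning of each command is given by `Exec`. -/
inductive Cmd where
  | skip : Cmd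
  | const (r k : ℕ) : Cmd
  | add (r a b : ℕ) : Cmd
  | sub (r a b : ℕ) : Cmd
  | load (r a : ℕ) : Cmd
  | store (a b : ℕ) : Cmd
  | seq (c d : Cmd) : Cmd
  | ifNonzero (r : ℕ) (c d : Cmd) : Cmd
  | whileNonzero (r : ℕ) (c : Cmd) : Cmd

/-- `Exec c s s' t`: the program `c`, started in the state `s`, halts in the state `s'` after
exactly `t` steps. Every elementary command and every test of a register costs one step. -/
inductive Exec : Cmd → State → State → ℕ → Prop where
  | skip (s : State) : Exec .skip s s 1
  | const (r k : ℕ) (s : State) : Exec (.const r k) s (s.setReg r k) 1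
  | add (r a b : ℕ) (s : State) : Exec (.add r a b) s (s.setReg r (s.reg a + s.reg b)) 1
  | sub (r a b : ℕ) (s : State) : Exec (.sub r a b) s (s.setReg r (s.reg a - s.reg b)) 1
  | load (r a : ℕ) (s : State) : Exec (.load r a) s (s.setReg r (s.mem (s.reg a))) 1
  | store (a b : ℕ) (s : State) : Exec (.store a b) s (s.setMem (s.reg a) (s.reg b)) 1
  | seq {c d : Cmd} {s₁ s₂ s₃ : State} {t u : ℕ} :
      Exec c s₁ s₂ t → Exec d s₂ s₃ u → Exec (.seq c d) s₁ s₃ (t + u)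
  | ifTrue {r : ℕ} {c d : Cmd} {s s' : State} {t : ℕ} :
      s.reg r ≠ 0 → Exec c s s' t → Exec (.ifNonzero r c d) s s' (t + 1)
  | ifFalse {r : ℕ} {c d : Cmd} {s s' : State} {t : ℕ} :
      s.reg r = 0 → Exec d s s' t → Exec (.ifNonzero r c d) s s' (t + 1)
  | whileStop {r : ℕ} {c : Cmd} {s : State} :
      s.reg r = 0 → Exec (.whileNonzero r c) s s 1
  | whileStep {r : ℕ} {c : Cmd} {s₁ s₂ s₃ : State} {t u : ℕ} :
      s₁.reg r ≠ 0 → Exec c s₁ s₂ t → Exec (.whileNonzero r c) s₂ s₃ u →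
        Exec (.whileNonzero r c) s₁ s₃ (t + u + 1)

open Classical in
/-- The initial state on the input `G`, a graph with vertex set `{0, …, n - 1}`: register `R₀` holds
`n`, the memory cells `0, …, n² - 1` hold the adjacency matrix of `G` row by row, everything else is
`0`. -/
noncomputable def inputState {n : ℕ} (G : SimpleGraph (Fin n)) : State where
  reg := fun r => if r = 0 then n else 0
  mem := fun k => if ∃ i j : Fin n, G.Adj i j ∧ k = (i : ℕ) * n + (j : ℕ) then 1 else 0

open Classical in
/-- The output held by a final state: the memory cells `0, …, n² - 1` hold, row by row, the
symmetric `0`-`1` matrix of the edge set `F`. -/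
def HoldsOutput {n : ℕ} (s : State) (F : Set (Sym2 (Fin n))) : Prop :=
  ∀ i j : Fin n, s.mem ((i : ℕ) * n + (j : ℕ)) = if s(i, j) ∈ F then 1 else 0

/-- One program, running in time polynomial in the number of vertices, outputs on every input graph
of the class `C` an edge set that is a solution in the sense of `Sol`. -/
def EdgeSetComputableInPolyTime (C : ∀ n : ℕ, SimpleGraph (Fin n) → Prop)
    (Sol : ∀ n : ℕ, SimpleGraph (Fin n) → Set (Sym2 (Fin n)) → Prop) : Prop :=
  ∃ (c : Cmd) (P : Polynomial ℕ), ∀ (n : ℕ) (G : SimpleGraph (Fin n)), C n G →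
    ∃ (s : State) (t : ℕ) (F : Set (Sym2 (Fin n))),
      Exec c (inputState G) s t ∧ t ≤ P.eval n ∧ HoldsOutput s F ∧ Sol n G F

end CactusDeletion

/-! Upper bound: take a breadth first search tree, rooted at `v`, of a spanning cactus `H`. No edge
at `v` lies outside the tree, and the fundamental cycle of a non-tree edge `ab` uses the tree edge
from `a` to its parent. An edge lies in at most one cycle, so no vertex meets two non-tree edges
(`IsCoTree.unique`). The non-tree edges thus form a matching of `G - v`, and `H` has at most `n - 1`
edges plus the size of that matching (`IsCactus.exists_isMatching_ncard_le`). Conversely, for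
universal `v`, the star at `v` with any matching of `G - v` is a spanning cactus whose cycles are
triangles through `v` (`starPlus_isCactus`). This half works in every graph with a universal vertex.

Excluding `P₄` and `C₄` serves the existence of that vertex and the algorithm. It makes the
neighbourhoods of adjacent vertices nested, in the order of their codegrees
(`IsQuasiThreshold.adj_of_codegree_le`). Hence a vertex of least codegree is universal if the graph
is connected. Moreover a maximum matching of `G - v` can be found greedily: let `uw` be an edge
between unmatched vertices with the largest sum of codegrees. If a maximum matching extending the
current one contains `ux` and `wy` instead, nestedness makes `x` and `y` adjacent, and `uw`, `xy`
can replace the two edges (`IsExtendable.mul_swap_of_codegree`). The program scans all pairs for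
each possible sum, in descending order, and erases the edges of the cactus from the matrix; what
remains is the deletion set. It takes `O(n⁴)` steps. -/

namespace CactusDeletion

/-! ### Quasi-threshold graphs -/

section QuasiThreshold

variable {V : Type*} {G : SimpleGraph V}

/-- In a quasi-threshold graph no edge `ab` extends to a walk `x a b y` with `x`, `b` and with
`a`, `y` distinct and nonadjacent. -/
theorem IsQuasiThreshold.adj_or_adj (hG : IsQuasiThreshold G) {x a b y : V} (hxa : G.Adj x a)
    (hab : G.Adj a b) (hby : G.Adj b y) (hxb : x ≠ b) (hay : a ≠ y) :
    G.Adj x b ∨ G.Adj a y := by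
  by_contra! hcon
  obtain ⟨nxb, nay⟩ := hcon
  have hxy : x ≠ y := by
    rintro rfl
    exact nay hxa.symm
  have h1 := hxa.ne
  have h2 := hab.ne
  have h3 := hby.ne
  have inj : Function.Injective ![x, a, b, y] := by
    intro i j h
    fin_cases i <;> fin_cases j <;> simp_all
  have s1 := hxa.symm
  have s2 := hab.symm
  have s3 := hby.symm
  have t1 : ¬ G.Adj b x := fun h => nxb h.symm
  have t2 : ¬ G.Adj y a := fun h => nay h.symm
  -- The pair `xy` decides which forbidden graph the four vertices induce: `C₄` if adjacent, `P₄` if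
  -- not.
  by_cases c : G.Adj x y
  · have c' := c.symm
    refine hG.2 ⟨⟨⟨![x, a, b, y], inj⟩, ?_⟩⟩
    intro i j
    fin_cases i <;> fin_cases j <;>
      simp [SimpleGraph.cycleGraph_adj, *] <;> decide
  · have c' : ¬ G.Adj y x := fun h => c h.symm
    refine hG.1 ⟨⟨⟨![x, a, b, y], inj⟩, ?_⟩⟩
    intro i j
    fin_cases i <;> fin_cases j <;>
      simp [SimpleGraph.pathGraph_adj, *]

theorem IsQuasiThreshold.minus (hG : IsQuasiThreshold G) (v : V) :
    IsQuasiThreshold (minus G v) := by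
  have h : (CactusDeletion.minus G v).IsIndContained G := ⟨SimpleGraph.Embedding.induce _⟩
  exact ⟨fun h' => hG.1 (h'.trans h), fun h' => hG.2 (h'.trans h)⟩

open Classical in
/-- The number of vertices, `a` included, that are not adjacent to `a`. -/
noncomputable def codegree [Fintype V] (G : SimpleGraph V) (a : V) : ℕ :=
  (Finset.univ.filter fun b => ¬ G.Adj a b).card

variable [Fintype V]

/-- Were `x` not adjacent to `b`, every non-neighbour of `a` other than `a` would be a non-neighbour
of `b` other than `b` and `x`, by `adj_or_adj`. Then `b` would have the larger codegree. -/
theorem IsQuasiThreshold.adj_of_codegree_le (hG : IsQuasiThreshold G) {x a b : V}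
    (hab : G.Adj a b) (hle : codegree G b ≤ codegree G a) (hxa : G.Adj x a) (hxb : x ≠ b) :
    G.Adj x b := by
  classical
  by_contra hcon
  have hsub : (Finset.univ.filter fun y => ¬ G.Adj a y).erase a ⊆
      ((Finset.univ.filter fun y => ¬ G.Adj b y).erase b).erase x := by
    intro y hy
    simp only [Finset.mem_erase, Finset.mem_filter, Finset.mem_univ, true_and] at hy ⊢
    refine ⟨?_, ?_, fun h => ?_⟩
    · rintro rfl
      exact hy.2 hxa.symm
    · rintro rfl
      exact hy.2 hab
    · rcases hG.adj_or_adj hxa hab h hxb (Ne.symm hy.1) with h | h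
      · exact hcon h
      · exact hy.2 h
  have h1 := Finset.card_le_card hsub
  rw [Finset.card_erase_of_mem (by simp), Finset.card_erase_of_mem,
    Finset.card_erase_of_mem (by simp)] at h1
  · have hx : ({b, x} : Finset V) ⊆ (Finset.univ.filter fun y => ¬ G.Adj b y) := by
      intro y hy
      simp only [Finset.mem_insert, Finset.mem_singleton] at hy
      rcases hy with rfl | rfl
      · simp
      · simpa using fun h : G.Adj b _ => hcon h.symm
    have h2 := Finset.card_le_card hx
    rw [Finset.card_pair hxb.symm] at h2
    unfold codegree at hle
    omega
  · simpa [hxb] using fun h : G.Adj b _ => hcon h.symm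

theorem codegree_pos (a : V) : 0 < codegree G a :=
  Finset.card_pos.2 ⟨a, by simp⟩

theorem codegree_eq_one_iff {a : V} : codegree G a = 1 ↔ G.IsUniversal a := by
  classical
  unfold codegree
  constructor
  · intro h w hw
    by_contra hcon
    exact hw ((Finset.card_le_one.1 h.le) a (by simp) w (by simpa using hcon))
  · intro h
    rw [Finset.card_eq_one]
    refine ⟨a, ?_⟩
    ext w
    simp only [Finset.mem_filter, Finset.mem_univ, true_and, Finset.mem_singleton]
    constructor
    · intro hw
      by_contra hne
      exact hw (h (Ne.symm hne))
    · rintro rfl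
      simp

/-- Sums of codegrees of adjacent vertices thus stay below `2n`, which serves as the start of the
greedy countdown. -/
theorem codegree_lt_of_adj {a b : V} (h : G.Adj a b) : codegree G a < Fintype.card V :=
  Finset.card_lt_univ_of_notMem (x := b) (by simpa using h)

end QuasiThreshold

/-- A vertex `v` of least codegree is adjacent to all neighbours of its neighbours, so no walk from
`v` can leave its closed neighbourhood. -/
theorem IsQuasiThreshold.exists_isUniversal {V : Type*} [Finite V] {G : SimpleGraph V}
    (hG : IsQuasiThreshold G) (hc : G.Connected) : ∃ v, G.IsUniversal v := by
  have := Fintype.ofFinite V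
  have := hc.nonempty
  obtain ⟨v, hv⟩ := Finite.exists_min (codegree G)
  refine ⟨v, fun w hw => ?_⟩
  by_contra hcon
  obtain ⟨p⟩ := hc.preconnected v w
  obtain ⟨d, -, h1, h2⟩ := p.exists_boundary_dart {x | x = v ∨ G.Adj v x} (by simp)
    (by simpa [hw.symm] using hcon)
  simp only [Set.mem_ofPred_eq, not_or] at h1 h2
  rcases h1 with h1 | h1
  · exact h2.2 (h1 ▸ d.adj)
  · exact h2.2 (hG.adj_of_codegree_le h1.symm (hv _) d.adj.symm h2.1).symm

/-! ### Matchings avoiding a vertex -/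

section RelSubgraph

variable {V : Type*} {G : SimpleGraph V}

/-- The subgraph of `G - v` whose edges are the pairs in `R`, without isolated vertices. -/
def relSubgraph (G : SimpleGraph V) (v : V) (R : V → V → Prop) (hsymm : ∀ a b, R a b → R b a)
    (hadj : ∀ a b, R a b → G.Adj a b) : (minus G v).Subgraph where
  verts := {a | ∃ b : {w : V // w ≠ v}, R a b}
  Adj a b := R a b
  adj_sub h := hadj _ _ h
  edge_vert h := ⟨_, h⟩
  symm := ⟨fun _ _ h => hsymm _ _ h⟩

theorem relSubgraph_isMatching {v : V} {R : V → V → Prop} (hsymm : ∀ a b, R a b → R b a)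
    (hadj : ∀ a b, R a b → G.Adj a b) (huniq : ∀ a b c, R a b → R a c → b = c) :
    (relSubgraph G v R hsymm hadj).IsMatching := by
  rintro a ⟨b, hb⟩
  exact ⟨b, hb, fun c hc => Subtype.ext (huniq _ _ _ hc hb)⟩

theorem edgeSet_starPlus (v : V) (M : (minus G v).Subgraph) :
    (starPlus v M).edgeSet =
      (fun x => s(v, x)) '' {v}ᶜ ∪ Sym2.map Subtype.val '' M.edgeSet := by
  ext e
  induction e with
  | h a b =>
    simp only [SimpleGraph.mem_edgeSet, Set.mem_union, Set.mem_image, Set.mem_compl_iff,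
      Set.mem_singleton_iff]
    constructor
    · rintro (⟨rfl, h⟩ | ⟨rfl, h⟩ | ⟨ha, hb, h⟩)
      · exact Or.inl ⟨b, h, rfl⟩
      · exact Or.inl ⟨a, h, Sym2.eq_swap⟩
      · exact Or.inr ⟨s(⟨a, ha⟩, ⟨b, hb⟩), h, rfl⟩
    · rintro (⟨x, hx, h⟩ | ⟨e, he, h⟩)
      · rcases Sym2.eq_iff.1 h with ⟨rfl, rfl⟩ | ⟨rfl, rfl⟩
        · exact Or.inl ⟨rfl, hx⟩
        · exact Or.inr (Or.inl ⟨rfl, hx⟩)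
      · induction e with
        | h c d =>
          rcases Sym2.eq_iff.1 h with ⟨rfl, rfl⟩ | ⟨rfl, rfl⟩
          · exact Or.inr (Or.inr ⟨c.2, d.2, he⟩)
          · exact Or.inr (Or.inr ⟨d.2, c.2, SimpleGraph.Subgraph.adj_symm M he⟩)

theorem ncard_edgeSet_starPlus [Finite V] (v : V) (M : (minus G v).Subgraph) :
    (starPlus v M).edgeSet.ncard = ({v}ᶜ : Set V).ncard + M.edgeSet.ncard := by
  rw [edgeSet_starPlus, Set.ncard_union_eq, Set.ncard_image_of_injective,
    Set.ncard_image_of_injective]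
  · exact Sym2.map.injective Subtype.val_injective
  · exact fun x y h => Sym2.congr_right.1 h
  · rw [Set.disjoint_left]
    rintro _ ⟨x, hx, rfl⟩ ⟨e, he, h⟩
    induction e with
    | h c d =>
      rcases Sym2.eq_iff.1 h with ⟨h, -⟩ | ⟨-, h⟩
      · exact c.2 h
      · exact d.2 h

end RelSubgraph

/-! ### Cacti have few edges -/

section UpperBound

variable {V : Type*} {H : SimpleGraph V}

/-- `par` maps each vertex other than `v` to a neighbour that is closer to `v`. -/
def IsParent (H : SimpleGraph V) (v : V) (par : V → V) : Prop :=
  ∀ x, x ≠ v → H.Adj x (par x) ∧ H.dist v (par x) + 1 = H.dist v x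

theorem exists_isParent (hc : H.Connected) (v : V) : ∃ par, IsParent H v par := by
  have h : ∀ x, ∃ y, x ≠ v → H.Adj x y ∧ H.dist v y + 1 = H.dist v x := by
    intro x
    by_cases hx : x = v
    · exact ⟨x, fun h => absurd hx h⟩
    obtain ⟨p, hp⟩ := hc.exists_walk_length_eq_dist x v
    cases p with
    | nil => exact absurd rfl hx
    | cons hxy q =>
      rename_i y
      refine ⟨y, fun _ => ⟨hxy, ?_⟩⟩
      have h1 := SimpleGraph.dist_le q
      have h2 := (hc.dist_triangle : H.dist x v ≤ H.dist x y + H.dist y v)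
      rw [SimpleGraph.dist_eq_one_iff_adj.2 hxy] at h2
      rw [SimpleGraph.Walk.length_cons] at hp
      rw [H.dist_comm (u := v) (v := y), H.dist_comm (u := v) (v := x)]
      omega
  choose par hpar using h
  exact ⟨par, hpar⟩

/-- The tree formed by the edges from vertices to their parents. -/
def parentTree (v : V) (par : V → V) : SimpleGraph V :=
  SimpleGraph.fromRel fun x y => x ≠ v ∧ par x = y

variable {v : V} {par : V → V}

theorem parentTree_le (hp : IsParent H v par) : parentTree v par ≤ H := by
  rintro x y ⟨-, ⟨h, rfl⟩ | ⟨h, rfl⟩⟩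
  · exact (hp _ h).1
  · exact (hp _ h).1.symm

theorem parentTree_reachable (hc : H.Connected) (hp : IsParent H v par) (x : V) :
    (parentTree v par).Reachable x v := by
  induction hd : H.dist v x generalizing x with
  | zero =>
    rw [(hc.dist_eq_zero_iff).1 hd]
  | succ d ih =>
    have hx : x ≠ v := by
      rintro rfl
      simp at hd
    have h := hp x hx
    refine SimpleGraph.Reachable.trans (SimpleGraph.Adj.reachable ?_) (ih (par x) (by omega))
    exact ⟨h.1.ne, Or.inl ⟨hx, rfl⟩⟩

/-- A tree walk that starts at `a` and avoids the edge from `a` to its parent stays among the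
descendants of `a`. -/
theorem exists_iterate_of_walk {a b c : V} (p : (parentTree v par).Walk c b)
    (hp : s(a, par a) ∉ p.edges) (hc : ∃ k, par^[k] c = a ∧ ∀ i < k, par^[i] c ≠ v) :
    ∃ k, par^[k] b = a ∧ ∀ i < k, par^[i] b ≠ v := by
  induction p with
  | nil => exact hc
  | cons h q ih =>
    rename_i x y z
    rw [SimpleGraph.Walk.edges_cons, List.mem_cons, not_or] at hp
    refine ih hp.2 ?_
    -- A step up to a parent shortens the chain to `a` by one and is excluded at `a` itself; a step
    -- down to a child lengthens it by one. The chain must avoid `v`, where `par` has no prescribed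
    -- value.
    obtain ⟨k, hk, hk'⟩ := hc
    obtain ⟨-, ⟨h1, rfl⟩ | ⟨h1, rfl⟩⟩ := h
    · cases k with
      | zero =>
        rw [Function.iterate_zero, id] at hk
        subst hk
        exact absurd rfl hp.1
      | succ k =>
        exact ⟨k, by rwa [Function.iterate_succ_apply] at hk, fun i hi => by
          rw [← Function.iterate_succ_apply]; exact hk' _ (by omega)⟩
    · refine ⟨k + 1, by rwa [Function.iterate_succ_apply], fun i hi => ?_⟩
      cases i with
      | zero => exact h1
      | succ i =>
        rw [Function.iterate_succ_apply]
        exact hk' _ (by omega)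

theorem dist_iterate (hp : IsParent H v par) {b : V} {k : ℕ} (h : ∀ i < k, par^[i] b ≠ v) :
    H.dist v (par^[k] b) + k = H.dist v b := by
  induction k with
  | zero => rfl
  | succ k ih =>
    have h1 := ih fun i hi => h i (by omega)
    have h2 := (hp _ (h k (by omega))).2
    rw [Function.iterate_succ_apply']
    omega

/-- The edges of `H` outside the parent tree. -/
def IsCoTree (H : SimpleGraph V) (v : V) (par : V → V) (a b : V) : Prop :=
  H.Adj a b ∧ ¬ (parentTree v par).Adj a b

theorem IsCoTree.symm {a b : V} (h : IsCoTree H v par a b) : IsCoTree H v par b a :=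
  ⟨h.1.symm, fun h' => h.2 h'.symm⟩

/-- A neighbour of the root has distance one from it, so its parent is the root and the edge belongs
to the tree. -/
theorem IsCoTree.ne_root (hc : H.Connected) (hp : IsParent H v par) {a b : V}
    (h : IsCoTree H v par a b) : a ≠ v := by
  rintro rfl
  have hb : b ≠ a := h.1.ne.symm
  have h1 := (hp b hb).2
  rw [SimpleGraph.dist_eq_one_iff_adj.2 h.1] at h1
  have h2 : a = par b := (hc.dist_eq_zero_iff).1 (by omega)
  exact h.2 ⟨hb.symm, Or.inr ⟨hb, h2.symm⟩⟩

/-- The fundamental cycle of an edge `ab` outside a breadth first search tree passes through the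
edge from `a` to its parent. -/
theorem IsCoTree.exists_cycle (hc : H.Connected) (hp : IsParent H v par) {a b : V}
    (h : IsCoTree H v par a b) :
    ∃ q : H.Walk b b, q.IsCycle ∧ s(a, b) ∈ q.edges ∧ s(a, par a) ∈ q.edges ∧
      ∀ e ∈ q.edges, e = s(a, b) ∨ e ∈ (parentTree v par).edgeSet := by
  obtain ⟨p, hpath⟩ := ((parentTree_reachable hc hp a).trans
    (parentTree_reachable hc hp b).symm).exists_isPath
  have hle := parentTree_le hp
  have hedges : (p.mapLe hle).edges = p.edges := by simp
  refine ⟨SimpleGraph.Walk.cons h.1.symm (p.mapLe hle), ?_, ?_, ?_, ?_⟩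
  · rw [SimpleGraph.Walk.cons_isCycle_iff, hedges]
    refine ⟨hpath.mapLe hle, fun hmem => h.symm.2 ?_⟩
    exact p.edges_subset_edgeSet hmem
  · rw [SimpleGraph.Walk.edges_cons, Sym2.eq_swap]
    exact List.mem_cons_self
  · rw [SimpleGraph.Walk.edges_cons, hedges]
    refine List.mem_cons_of_mem _ ?_
    by_contra hmem
    -- Otherwise `b` is a descendant of `a`, `k` levels below. Adjacency forces `k ≤ 1`; but `k = 0`
    -- means `a = b`, and `k = 1` makes `ab` a tree edge.
    obtain ⟨k, hk, hk'⟩ := exists_iterate_of_walk p hmem ⟨0, rfl, fun i hi => absurd hi (by omega)⟩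
    have hd := dist_iterate hp hk'
    rw [hk] at hd
    have htri := (hc.dist_triangle : H.dist v b ≤ H.dist v a + H.dist a b)
    rw [SimpleGraph.dist_eq_one_iff_adj.2 h.1] at htri
    have hk1 : k = 0 ∨ k = 1 := by omega
    rcases hk1 with rfl | rfl
    · exact h.1.ne hk.symm
    · exact h.2 ⟨h.1.ne, Or.inr ⟨hk' 0 (by omega), hk⟩⟩
  · intro e he
    rw [SimpleGraph.Walk.edges_cons, hedges, List.mem_cons, Sym2.eq_swap] at he
    exact he.imp_right fun he => p.edges_subset_edgeSet he

/-- Both fundamental cycles contain the edge from `a` to its parent, so they coincide; such a cycle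
has only one edge outside the tree. -/
theorem IsCoTree.unique (hH : IsCactus H) (hp : IsParent H v par) {a b c : V}
    (hb : IsCoTree H v par a b) (hc : IsCoTree H v par a c) : b = c := by
  obtain ⟨q, hq, hab, haq, hqe⟩ := hb.exists_cycle hH.1 hp
  obtain ⟨r, hr, hac, har, hre⟩ := hc.exists_cycle hH.1 hp
  have heq := hH.2 _ _ q r hq hr _ haq har
  rw [← SimpleGraph.Walk.mem_edges_toSubgraph, heq, SimpleGraph.Walk.mem_edges_toSubgraph] at hab
  rcases hre _ hab with h | h
  · exact Sym2.congr_right.1 h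
  · exact absurd h hb.2

/-- A spanning cactus of `G` has at most as many edges as the graph formed by a star and a suitable
matching of `G - v`. -/
theorem IsCactus.exists_isMatching_ncard_le [Finite V] {G : SimpleGraph V} (hH : IsCactus H)
    (hle : H ≤ G) (v : V) : ∃ M : (minus G v).Subgraph, M.IsMatching ∧
      H.edgeSet.ncard ≤ (starPlus v M).edgeSet.ncard := by
  obtain ⟨par, hp⟩ := exists_isParent hH.1 v
  refine ⟨relSubgraph G v (IsCoTree H v par) (fun _ _ => IsCoTree.symm) (fun _ _ h => hle h.1),
    relSubgraph_isMatching _ _ fun _ _ _ => IsCoTree.unique hH hp, ?_⟩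
  rw [ncard_edgeSet_starPlus]
  -- Tree edges are indexed by their lower ends, at most one for each spoke of the star; the others
  -- form the matching.
  have hsub : H.edgeSet ⊆ (fun x => s(x, par x)) '' {v}ᶜ ∪ Sym2.map Subtype.val ''
      (relSubgraph G v (IsCoTree H v par) (fun _ _ => IsCoTree.symm)
        (fun _ _ h => hle h.1)).edgeSet := by
    intro e he
    induction e with
    | h a b =>
      by_cases ht : (parentTree v par).Adj a b
      · obtain ⟨-, ⟨h, rfl⟩ | ⟨h, rfl⟩⟩ := ht
        · exact Or.inl ⟨a, h, rfl⟩
        · exact Or.inl ⟨b, h, Sym2.eq_swap⟩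
      · have hco : IsCoTree H v par a b := ⟨he, ht⟩
        exact Or.inr ⟨s(⟨a, hco.ne_root hH.1 hp⟩, ⟨b, hco.symm.ne_root hH.1 hp⟩), hco, rfl⟩
  refine (Set.ncard_le_ncard hsub).trans ((Set.ncard_union_le _ _).trans ?_)
  exact add_le_add (Set.ncard_image_le) (Set.ncard_image_le)

end UpperBound

/-! ### A star together with a matching -/

section StarPlus

variable {V : Type*} {G : SimpleGraph V} {v : V} {M : (minus G v).Subgraph}

theorem starPlus_isUniversal : (starPlus v M).IsUniversal v :=
  fun _ hw => Or.inl ⟨rfl, hw.symm⟩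

theorem starPlus_le (hv : G.IsUniversal v) : starPlus v M ≤ G := by
  rintro a b (⟨rfl, h⟩ | ⟨rfl, h⟩ | ⟨ha, hb, h⟩)
  · exact hv h.symm
  · exact (hv h.symm).symm
  · exact M.adj_sub h

theorem starPlus_adj_unique (hM : M.IsMatching) {a b c : V} (ha : a ≠ v) (hb : b ≠ v) (hc : c ≠ v)
    (hab : (starPlus v M).Adj a b) (hac : (starPlus v M).Adj a c) : b = c := by
  rcases hab with ⟨h, -⟩ | ⟨h, -⟩ | ⟨_, _, h⟩
  · exact absurd h ha
  · exact absurd h hb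
  rcases hac with ⟨h', -⟩ | ⟨h', -⟩ | ⟨_, _, h'⟩
  · exact absurd h' ha
  · exact absurd h' hc
  · exact congrArg Subtype.val (hM.eq_of_adj_left h h')

/-- A vertex other than `v` has at most one neighbour other than `v`, whereas a cycle provides two.
-/
theorem mem_support_of_isCycle_starPlus (hM : M.IsMatching) {u : V} {p : (starPlus v M).Walk u u}
    (hp : p.IsCycle) : v ∈ p.support := by
  by_contra hv
  have h2 := hp.ncard_neighborSet_toSubgraph_eq_two p.start_mem_support
  obtain ⟨x, y, hxy, hset⟩ := Set.ncard_eq_two.1 h2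
  have key : ∀ z ∈ p.toSubgraph.neighborSet u, z ≠ v ∧ (starPlus v M).Adj u z := by
    intro z hz
    refine ⟨?_, p.toSubgraph.adj_sub hz⟩
    rintro rfl
    exact hv (p.mem_verts_toSubgraph.1 (p.toSubgraph.edge_vert hz.symm))
  have hu : u ≠ v := by
    rintro rfl
    exact hv p.start_mem_support
  obtain ⟨hx, hux⟩ := key x (by rw [hset]; simp)
  obtain ⟨hy, huy⟩ := key y (by rw [hset]; simp)
  exact hxy (starPlus_adj_unique hM hu hx hy hux huy)

theorem edges_of_isCycle_starPlus (hM : M.IsMatching) {p : (starPlus v M).Walk v v}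
    (hp : p.IsCycle) : ∃ a b, a ≠ v ∧ b ≠ v ∧ (starPlus v M).Adj a b ∧
      p.edges = [s(v, a), s(a, b), s(b, v)] := by
  cases p with
  | nil => exact absurd hp SimpleGraph.Walk.not_isCycle_nil
  | cons h1 q =>
    rename_i a
    have ha : a ≠ v := h1.ne.symm
    rw [SimpleGraph.Walk.cons_isCycle_iff] at hp
    obtain ⟨hq, hne⟩ := hp
    cases q with
    | nil => exact absurd rfl ha
    | cons h2 r =>
      rename_i b
      rw [SimpleGraph.Walk.edges_cons, List.mem_cons, not_or] at hne
      have hb : b ≠ v := by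
        rintro rfl
        exact hne.1 Sym2.eq_swap
      rw [SimpleGraph.Walk.cons_isPath_iff] at hq
      obtain ⟨hr, har⟩ := hq
      cases r with
      | nil => exact absurd rfl hb
      | cons h3 t =>
        rename_i c
        -- The only neighbour of `b` besides `v` is `a`, which the path has already left.
        have hc : c = v := by
          by_contra hc
          refine har ?_
          rw [starPlus_adj_unique hM hb ha hc h2.symm h3]
          simp
        subst hc
        rw [SimpleGraph.Walk.cons_isPath_iff, SimpleGraph.Walk.isPath_iff_nil] at hr
        obtain rfl := hr.1.eq_nil
        exact ⟨a, b, ha, hb, h2, by simp⟩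

theorem mem_edges_of_isCycle_starPlus (hM : M.IsMatching) {u : V} {p : (starPlus v M).Walk u u}
    (hp : p.IsCycle) : p.length = 3 ∧ ∃ a b, a ≠ v ∧ b ≠ v ∧ (starPlus v M).Adj a b ∧
      ∀ e, e ∈ p.edges ↔ e = s(v, a) ∨ e = s(a, b) ∨ e = s(b, v) := by
  classical
  have hv := mem_support_of_isCycle_starPlus hM hp
  obtain ⟨a, b, ha, hb, hab, he⟩ := edges_of_isCycle_starPlus hM (hp.rotate hv)
  have hperm := (p.rotate_edges v hv).perm
  refine ⟨?_, a, b, ha, hb, hab, fun e => ?_⟩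
  · rw [← SimpleGraph.Walk.length_edges, ← hperm.length_eq, he]
    rfl
  · rw [← hperm.mem_iff, he]
    simp

/-- Every vertex of a cycle lies on one of its edges, so the edges determine the subgraph. -/
theorem subgraph_eq_of_edges {H : SimpleGraph V} {a b : V} {p : H.Walk a a} {q : H.Walk b b}
    (hp : p.IsCycle) (hq : q.IsCycle) (h : ∀ e, e ∈ p.edges ↔ e ∈ q.edges) :
    p.toSubgraph = q.toSubgraph := by
  have key : ∀ {a b : V} {p : H.Walk a a} {q : H.Walk b b}, p.IsCycle → q.IsCycle →
      (∀ e, e ∈ p.edges ↔ e ∈ q.edges) → p.toSubgraph ≤ q.toSubgraph := by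
    intro a b p q hp hq h
    have hadj : ∀ x y, p.toSubgraph.Adj x y → q.toSubgraph.Adj x y := by
      intro x y hxy
      rw [← SimpleGraph.Subgraph.mem_edgeSet, SimpleGraph.Walk.mem_edges_toSubgraph] at hxy ⊢
      exact (h _).1 hxy
    refine ⟨fun x hx => ?_, hadj⟩
    have h2 := hp.ncard_neighborSet_toSubgraph_eq_two (p.mem_verts_toSubgraph.1 hx)
    obtain ⟨y, hy⟩ := Set.nonempty_of_ncard_ne_zero (by rw [h2]; decide)
    exact q.toSubgraph.edge_vert (hadj _ _ hy)
  exact le_antisymm (key hp hq h) (key hq hp fun e => (h e).symm)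

/-- Two triangles with a common edge share a vertex other than `v`, and its partner in the matching
is unique. -/
theorem starPlus_isCactus (hM : M.IsMatching) : IsCactus (starPlus v M) := by
  refine ⟨SimpleGraph.Connected.of_isUniversal starPlus_isUniversal, ?_⟩
  intro _ _ p q hp hq e hep heq
  obtain ⟨-, a, b, ha, hb, hab, hpe⟩ := mem_edges_of_isCycle_starPlus hM hp
  obtain ⟨-, c, d, hc, hd, hcd, hqe⟩ := mem_edges_of_isCycle_starPlus hM hq
  have huniq : ∀ {a b c : V}, a ≠ v → b ≠ v → c ≠ v → (starPlus v M).Adj a b →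
      (starPlus v M).Adj a c → b = c := starPlus_adj_unique hM
  have hcases : (a = c ∧ b = d) ∨ (a = d ∧ b = c) := by
    have h1 := (hpe e).1 hep
    have h2 := (hqe e).1 heq
    have h3 : a = c ∨ a = d ∨ b = c ∨ b = d := by
      rcases h1 with rfl | rfl | rfl <;> rcases h2 with h2 | h2 | h2 <;>
        rcases Sym2.eq_iff.1 h2 with ⟨h4, h5⟩ | ⟨h4, h5⟩ <;> simp_all
    rcases h3 with rfl | rfl | rfl | rfl
    · exact Or.inl ⟨rfl, huniq ha hb hd hab hcd⟩
    · exact Or.inr ⟨rfl, huniq ha hb hc hab hcd.symm⟩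
    · exact Or.inr ⟨huniq hb ha hd hab.symm hcd, rfl⟩
    · exact Or.inl ⟨huniq hb ha hc hab.symm hcd.symm, rfl⟩
  refine subgraph_eq_of_edges hp hq fun e => ?_
  rw [hpe, hqe]
  rcases hcases with ⟨rfl, rfl⟩ | ⟨rfl, rfl⟩
  · rfl
  · rw [Sym2.eq_swap (a := v) (b := a), Sym2.eq_swap (a := v) (b := b),
      Sym2.eq_swap (a := a) (b := b)]
    tauto

variable [Finite V]

theorem starPlus_isMaxSpanningCactus (hv : G.IsUniversal v) (hM : IsMaxMatching M) :
    IsMaxSpanningCactus G (starPlus v M) := by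
  refine ⟨starPlus_le hv, starPlus_isCactus hM.1, fun H hle hH => ?_⟩
  obtain ⟨N, hN, h⟩ := hH.exists_isMatching_ncard_le hle v
  refine h.trans ?_
  rw [ncard_edgeSet_starPlus, ncard_edgeSet_starPlus]
  exact Nat.add_le_add_left (hM.2 N hN) _

theorem IsMaxSpanningCactus.isMinCactusDeletion {H : SimpleGraph V}
    (hH : IsMaxSpanningCactus G H) : IsMinCactusDeletion G (G.edgeSet \ H.edgeSet) := by
  have hle : H.edgeSet ⊆ G.edgeSet := SimpleGraph.edgeSet_mono hH.1
  have hdel : G.deleteEdges (G.edgeSet \ H.edgeSet) = H := by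
    rw [← SimpleGraph.edgeSet_inj, SimpleGraph.edgeSet_deleteEdges, Set.sdiff_sdiff_cancel_left hle]
  refine ⟨Set.sdiff_subset, by rw [hdel]; exact hH.2.1, fun F hF hc => ?_⟩
  have h1 := hH.2.2 _ (SimpleGraph.deleteEdges_le F) hc
  rw [SimpleGraph.edgeSet_deleteEdges] at h1
  have h2 := Set.ncard_sdiff_add_ncard_of_subset hF
  have h3 := Set.ncard_sdiff_add_ncard_of_subset hle
  omega

theorem exists_isMaxMatching {W : Type*} [Finite W] (K : SimpleGraph W) :
    ∃ M : K.Subgraph, IsMaxMatching M := by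
  obtain ⟨M, hM, hmax⟩ := Set.exists_max_image {M : K.Subgraph | M.IsMatching}
    (fun M => M.edgeSet.ncard) (Set.toFinite _) ⟨⊥, fun a ha => absurd ha (by simp)⟩
  exact ⟨M, hM, hmax⟩

end StarPlus

/-! ### Matchings as involutions and the greedy algorithm -/

section PermMatching

open Equiv

variable {V : Type*} {K : SimpleGraph V}

/-- An involution that moves every vertex to a neighbour or not at all, that is, a matching. -/
structure IsPermMatching (K : SimpleGraph V) (f : Perm V) : Prop where
  invol : ∀ x, f (f x) = x
  adj : ∀ x, f x ≠ x → K.Adj x (f x)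

theorem IsPermMatching.apply_eq_iff {f : Perm V} (hf : IsPermMatching K f) {x y : V} :
    f x = y ↔ f y = x := by
  constructor <;> rintro rfl <;> exact hf.invol _

theorem isPermMatching_one : IsPermMatching K (1 : Perm V) :=
  ⟨fun _ => rfl, fun _ h => absurd rfl h⟩

/-- The involution exchanges each vertex with its only neighbour and fixes isolated vertices.
Matchings become permutations, so that rematching can be done by conjugation. -/
theorem exists_perm_of_unique {L : SimpleGraph V} (h : ∀ x y z, L.Adj x y → L.Adj x z → y = z) :
    ∃ f : Perm V, IsPermMatching L f ∧ ∀ x y, L.Adj x y ↔ f x = y ∧ x ≠ y := by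
  classical
  have hex : ∀ x, ∃ y, L.Adj x y ∨ (y = x ∧ ∀ z, ¬ L.Adj x z) := by
    intro x
    by_cases hx : ∃ y, L.Adj x y
    · exact hx.imp fun y => Or.inl
    · exact ⟨x, Or.inr ⟨rfl, not_exists.1 hx⟩⟩
  choose g hg using hex
  have hadj : ∀ x y, L.Adj x y → g x = y := by
    intro x y hxy
    rcases hg x with h1 | ⟨-, h1⟩
    · exact h _ _ _ h1 hxy
    · exact absurd hxy (h1 y)
  have hinv : Function.Involutive g := by
    intro x
    rcases hg x with h1 | ⟨h1, -⟩
    · exact hadj _ _ h1.symm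
    · rw [h1, h1]
  refine ⟨hinv.toPerm, ⟨hinv, fun x hx => ?_⟩, fun x y => ⟨fun hxy => ⟨hadj x y hxy, hxy.ne⟩, ?_⟩⟩
  · exact (hg x).resolve_right fun h1 => hx h1.1
  · rintro ⟨rfl, hne⟩
    exact (hg x).resolve_right fun h1 => hne h1.1.symm

variable [DecidableEq V]

theorem IsPermMatching.mul_swap {f : Perm V} (hf : IsPermMatching K f) {u w : V}
    (huw : K.Adj u w) (hu : f u = u) (hw : f w = w) : IsPermMatching K (f * swap u w) := by
  have hne := huw.ne
  have h : ∀ z, z ≠ u → z ≠ w → f z ≠ u ∧ f z ≠ w := fun z h1 h2 =>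
    ⟨fun h => h1 (by rw [← hf.invol z, h, hu]), fun h => h2 (by rw [← hf.invol z, h, hw])⟩
  refine ⟨fun z => ?_, fun z => ?_⟩ <;> by_cases hzu : z = u
  · subst hzu
    simp [hw, hu]
  · by_cases hzw : z = w
    · subst hzw
      simp [hw, hu]
    · simp [swap_apply_of_ne_of_ne hzu hzw, swap_apply_of_ne_of_ne (h z hzu hzw).1 (h z hzu hzw).2,
        hf.invol]
  · subst hzu
    simpa [hw] using fun _ => huw
  · by_cases hzw : z = w
    · subst hzw
      simpa [hu] using fun _ => huw.symm
    · simpa [swap_apply_of_ne_of_ne hzu hzw] using hf.adj z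

/-- If `a` and `b` are moved to different places, then conjugation with `swap (f u) w` makes `u` and
`w` partners. -/
theorem IsPermMatching.conj {f : Perm V} (hf : IsPermMatching K f) {u w : V}
    (huw : K.Adj u w) (hfu : f u ≠ u) (hfw : f u ≠ w)
    (hex : f w ≠ w → K.Adj (f u) (f w)) :
    IsPermMatching K (swap (f u) w * f * swap (f u) w) ∧
      (swap (f u) w * f * swap (f u) w) u = w ∧
      ∀ z, z ≠ u → z ≠ w → z ≠ f u → z ≠ f w → (swap (f u) w * f * swap (f u) w) z = f z := by
  have hne := huw.ne
  -- The conjugation relabels `f u` and `w`: the pairs `{u, f u}`, `{w, f w}` turn into `{u, w}`,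
  -- `{f u, f w}`. If `f` fixes `w`, then `f u` becomes unmatched.
  have hu : (swap (f u) w * f * swap (f u) w) u = w := by
    simp [swap_apply_of_ne_of_ne hfu.symm hne]
  have hrest : ∀ z, z ≠ u → z ≠ w → z ≠ f u → z ≠ f w →
      (swap (f u) w * f * swap (f u) w) z = f z := by
    intro z h1 h2 h3 h4
    rw [Perm.mul_apply, Perm.mul_apply, swap_apply_of_ne_of_ne h3 h2, swap_apply_of_ne_of_ne]
    · exact fun h => h1 (f.injective h)
    · exact fun h => h4 (hf.apply_eq_iff.1 h).symm
  have hinv : ∀ z, (swap (f u) w * f * swap (f u) w) ((swap (f u) w * f * swap (f u) w) z) = z := by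
    intro z
    simp [hf.invol]
  refine ⟨⟨hinv, fun z hz => ?_⟩, hu, hrest⟩
  have hw : (swap (f u) w * f * swap (f u) w) w = u := by
    have := hinv u
    rwa [hu] at this
  by_cases h1 : z = u
  · subst h1
    rwa [hu]
  by_cases h2 : z = w
  · subst h2
    rw [hw]
    exact huw.symm
  by_cases hww : f w = w
  · by_cases h3 : z = f u
    · subst h3
      refine absurd ?_ hz
      simp [hww]
    · rw [hrest z h1 h2 h3 (by rwa [hww])] at hz ⊢
      exact hf.adj z hz
  · have hfwu : f w ≠ f u := fun h => hne (f.injective h).symm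
    have hx : (swap (f u) w * f * swap (f u) w) (f u) = f w := by
      simp [swap_apply_of_ne_of_ne hfwu hww]
    by_cases h3 : z = f u
    · subst h3
      rw [hx]
      exact hex hww
    by_cases h4 : z = f w
    · subst h4
      have := hinv (f u)
      rw [hx] at this
      rw [this]
      exact (hex hww).symm
    rw [hrest z h1 h2 h3 h4] at hz ⊢
    exact hf.adj z hz

variable [Fintype V]

/-- A maximum matching, as an involution. -/
def IsMaxPermMatching (K : SimpleGraph V) (f : Perm V) : Prop :=
  IsPermMatching K f ∧ ∀ g, IsPermMatching K g → g.support.card ≤ f.support.card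

/-- A matching that is part of a maximum matching. -/
def IsExtendable (K : SimpleGraph V) (m : Perm V) : Prop :=
  IsPermMatching K m ∧ ∃ f, IsMaxPermMatching K f ∧ ∀ x, m x ≠ x → f x = m x

theorem isExtendable_one : IsExtendable K (1 : Perm V) := by
  obtain ⟨f, hf, hmax⟩ := Set.exists_max_image {f : Perm V | IsPermMatching K f}
    (fun f => f.support.card) (Set.toFinite _) ⟨1, isPermMatching_one⟩
  exact ⟨isPermMatching_one, f, ⟨hf, hmax⟩, fun x h => absurd rfl h⟩

/-- The exchange step. -/
theorem IsExtendable.mul_swap {m : Perm V} (hm : IsExtendable K m) {u w : V} (huw : K.Adj u w)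
    (hu : m u = u) (hw : m w = w)
    (hex : ∀ x y, K.Adj u x → K.Adj w y → m x = x → m y = y → x ≠ y → x ≠ w → y ≠ u →
      K.Adj x y) : IsExtendable K (m * swap u w) := by
  obtain ⟨hm, f, ⟨hf, hmax⟩, hext⟩ := hm
  -- The partners under `f` of vertices unmatched by `m` are unmatched by `m` as well, so rematching
  -- `u` and `w` leaves the pairs of `m` intact.
  have hfix : ∀ z, m z = z → m (f z) = f z := by
    intro z hz
    by_contra h
    have h1 := hext _ h
    rw [hf.invol] at h1
    have h2 : z = f z := hz.symm.trans (hm.apply_eq_iff.1 h1.symm)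
    rw [← h2] at h
    exact h hz
  suffices h : ∃ g, IsMaxPermMatching K g ∧ g u = w ∧ ∀ x, m x ≠ x → g x = m x by
    obtain ⟨g, hg, hgu, hgm⟩ := h
    refine ⟨hm.mul_swap huw hu hw, g, hg, fun x hx => ?_⟩
    by_cases h1 : x = u
    · subst h1
      simp [hgu, hw]
    by_cases h2 : x = w
    · subst h2
      simp [hu, hg.1.apply_eq_iff.1 hgu]
    rw [Perm.mul_apply, swap_apply_of_ne_of_ne h1 h2] at hx ⊢
    exact hgm x hx
  by_cases hfuw : f u = w
  · exact ⟨f, ⟨hf, hmax⟩, hfuw, hext⟩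
  have hfwu : f w ≠ u := fun h => hfuw (hf.apply_eq_iff.1 h)
  have hmoved : ∀ z, m z ≠ z → z ≠ u ∧ z ≠ w ∧ z ≠ f u ∧ z ≠ f w := by
    intro z hz
    refine ⟨?_, ?_, ?_, ?_⟩ <;> rintro rfl
    · exact hz hu
    · exact hz hw
    · exact hz (hfix _ hu)
    · exact hz (hfix _ hw)
  -- Conjugation preserves the size of the support, so the rematched involution is again maximum.
  have hcard : ∀ (a b : V), (swap a b * f * swap a b).support.card = f.support.card := by
    intro a b
    have := Perm.card_support_conj (σ := swap a b) (τ := f)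
    rwa [swap_inv] at this
  by_cases hfu : f u = u
  · by_cases hfw : f w = w
    -- If `f` leaves both `u` and `w` unmatched, adding `uw` would enlarge it.
    · have h1 := hmax _ (hf.mul_swap huw hfu hfw)
      have hd : Perm.Disjoint f (swap u w) := by
        intro z
        by_cases h1 : z = u
        · exact Or.inl (h1 ▸ hfu)
        by_cases h2 : z = w
        · exact Or.inl (h2 ▸ hfw)
        exact Or.inr (swap_apply_of_ne_of_ne h1 h2)
      rw [hd.card_support_mul, Perm.card_support_swap huw.ne] at h1
      omega
    · obtain ⟨h1, h2, h3⟩ := hf.conj huw.symm hfw hfwu fun h => absurd hfu h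
      refine ⟨_, ⟨h1, fun g hg => (hmax g hg).trans (hcard _ _).ge⟩, h1.apply_eq_iff.1 h2,
        fun x hx => ?_⟩
      obtain ⟨e1, e2, e3, e4⟩ := hmoved x hx
      rw [h3 x e2 e1 e4 e3, hext x hx]
  · obtain ⟨h1, h2, h3⟩ := hf.conj huw hfu hfuw fun hfw =>
      hex _ _ (hf.adj u hfu) (hf.adj w hfw) (hfix _ hu) (hfix _ hw)
        (fun h => huw.ne (f.injective h)) hfuw hfwu
    refine ⟨_, ⟨h1, fun g hg => (hmax g hg).trans (hcard _ _).ge⟩, h2, fun x hx => ?_⟩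
    obtain ⟨e1, e2, e3, e4⟩ := hmoved x hx
    rw [h3 x e1 e2 e3 e4, hext x hx]

/-- A matching to which no edge can be added has no proper extension, so the maximum matching
extending it is the matching itself. -/
theorem IsExtendable.isMaxPermMatching {m : Perm V} (hm : IsExtendable K m)
    (h : ∀ a b, K.Adj a b → m a = a → m b ≠ b) : IsMaxPermMatching K m := by
  obtain ⟨hm, f, hf, hext⟩ := hm
  have : f = m := by
    ext x
    by_cases hx : m x = x
    · by_contra hne
      rw [hx] at hne
      have h1 := h _ _ (hf.1.adj x hne) hx
      have h2 := hext _ h1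
      rw [hf.1.invol] at h2
      have h3 := hm.apply_eq_iff.1 h2.symm
      exact hne (h3 ▸ hx)
    · exact hext x hx
  exact this ▸ hf

theorem card_support_eq_two_mul {L : SimpleGraph V} {f : Perm V}
    (h : ∀ x y, L.Adj x y ↔ f x = y ∧ x ≠ y) : f.support.card = 2 * L.edgeSet.ncard := by
  classical
  have h1 := L.two_mul_card_edgeFinset
  rw [← L.coe_edgeFinset, Set.ncard_coe_finset, h1]
  refine Finset.card_bij (fun x _ => (x, f x)) ?_ ?_ ?_
  · intro x hx
    simpa [h] using (Perm.mem_support.1 hx).symm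
  · intro x _ y _ hxy
    exact congrArg Prod.fst hxy
  · rintro ⟨x, y⟩ hxy
    obtain ⟨rfl, hne⟩ := (h x y).1 (by simpa using hxy)
    exact ⟨x, Perm.mem_support.2 hne.symm, rfl⟩

end PermMatching

/-! ### Greedy matching in `G - v` by sums of codegrees -/

section Greedy

open Equiv

variable {V : Type*} {G : SimpleGraph V} {v : V}

/-- `G` without the edges at `v`. -/
def isolate (G : SimpleGraph V) (v : V) : SimpleGraph V where
  Adj a b := G.Adj a b ∧ a ≠ v ∧ b ≠ v
  symm := ⟨fun _ _ h => ⟨h.1.symm, h.2.2, h.2.1⟩⟩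
  loopless := ⟨fun _ h => h.1.ne rfl⟩

/-- The matching of `G - v` given by an involution. -/
def permSubgraph {m : Perm V} (hm : IsPermMatching (isolate G v) m) : (minus G v).Subgraph :=
  relSubgraph G v (fun a b => m a = b ∧ a ≠ b)
    (fun _ _ h => ⟨hm.apply_eq_iff.1 h.1, h.2.symm⟩)
    (fun a _ h => h.1 ▸ (hm.adj a fun h' => h.2 (h'.symm.trans h.1)).1)

theorem starPlus_permSubgraph_adj {m : Perm V} (hm : IsPermMatching (isolate G v) m) {a b : V} :
    (starPlus v (permSubgraph hm)).Adj a b ↔ a ≠ b ∧ (a = v ∨ b = v ∨ m a = b) := by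
  constructor
  · rintro (⟨rfl, h⟩ | ⟨rfl, h⟩ | ⟨_, _, h⟩)
    · exact ⟨h.symm, Or.inl rfl⟩
    · exact ⟨h, Or.inr (Or.inl rfl)⟩
    · exact ⟨h.2, Or.inr (Or.inr h.1)⟩
  · rintro ⟨hne, h⟩
    by_cases ha : a = v
    · exact Or.inl ⟨ha, fun hb => hne (ha.trans hb.symm)⟩
    by_cases hb : b = v
    · exact Or.inr (Or.inl ⟨hb, ha⟩)
    exact Or.inr (Or.inr ⟨ha, hb, (h.resolve_left ha).resolve_left hb, hne⟩)

variable [Fintype V] [DecidableEq V]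

/-- Any competing matching is also given by an involution, and in both models the number of edges is
half the size of the support. -/
theorem permSubgraph_isMaxMatching {m : Perm V} (hm : IsMaxPermMatching (isolate G v) m) :
    IsMaxMatching (permSubgraph hm.1) := by
  have hmap : ∀ M : (minus G v).Subgraph,
      (M.spanningCoe.map (Function.Embedding.subtype _)).edgeSet.ncard = M.edgeSet.ncard := by
    intro M
    rw [SimpleGraph.edgeSet_map, SimpleGraph.Subgraph.edgeSet_spanningCoe]
    exact Set.ncard_image_of_injective _ (Function.Embedding.injective _)
  have hadj : ∀ (M : (minus G v).Subgraph) (x y : V),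
      (M.spanningCoe.map (Function.Embedding.subtype _)).Adj x y ↔
        ∃ (hx : x ≠ v) (hy : y ≠ v), M.Adj ⟨x, hx⟩ ⟨y, hy⟩ := by
    intro M x y
    rw [SimpleGraph.map_adj]
    constructor
    · rintro ⟨a, b, h, rfl, rfl⟩
      exact ⟨a.2, b.2, h⟩
    · rintro ⟨hx, hy, h⟩
      exact ⟨⟨x, hx⟩, ⟨y, hy⟩, h, rfl, rfl⟩
  refine ⟨relSubgraph_isMatching _ _ fun _ _ _ h1 h2 => h1.1.symm.trans h2.1, fun M' hM' => ?_⟩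
  obtain ⟨f, hf, hfadj⟩ := exists_perm_of_unique
    (L := M'.spanningCoe.map (Function.Embedding.subtype _)) (by
      intro x y z hy hz
      obtain ⟨_, _, hy⟩ := (hadj _ _ _).1 hy
      obtain ⟨_, _, hz⟩ := (hadj _ _ _).1 hz
      exact congrArg Subtype.val (hM'.eq_of_adj_left hy hz))
  have h1 := card_support_eq_two_mul hfadj
  have h2 := card_support_eq_two_mul
    (L := (permSubgraph hm.1).spanningCoe.map (Function.Embedding.subtype _)) (f := m) (by
      intro x y
      rw [hadj]
      constructor
      · rintro ⟨_, _, h⟩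
        exact h
      · rintro ⟨rfl, hne⟩
        have h := hm.1.adj x hne.symm
        exact ⟨h.2.1, h.2.2, rfl, hne⟩)
  have h3 := hm.2 f ⟨hf.invol, fun x hx => by
    obtain ⟨e1, e2, h⟩ := (hadj _ _ _).1 (hf.adj x hx)
    exact ⟨M'.adj_sub h, e1, e2⟩⟩
  rw [hmap] at h1 h2
  omega

/-- Adding an edge between unmatched vertices that has the largest sum of codegrees. -/
theorem IsExtendable.mul_swap_of_codegree (hG : IsQuasiThreshold G) {m : Perm V}
    (hm : IsExtendable (isolate G v) m) {u w : V} (huw : (isolate G v).Adj u w) (hu : m u = u)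
    (hw : m w = w) (hmax : ∀ a b, (isolate G v).Adj a b → m a = a → m b = b →
      codegree G a + codegree G b ≤ codegree G u + codegree G w) :
    IsExtendable (isolate G v) (m * swap u w) := by
  refine hm.mul_swap huw hu hw fun x y hux hwy hx hy hxy hxw hyu => ?_
  refine ⟨?_, hux.2.2, hwy.2.2⟩
  have h1 := hmax u x hux hu hx
  have h2 := hmax w y hwy hw hy
  -- By maximality `x` has at most the codegree of `w`, and `y` at most that of `u`. If `w` has at
  -- most the codegree of `u`, then the neighbour `w` of `u` is adjacent to `x`, and hence so is the
  -- neighbour `y` of `w`. The other case is symmetric.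
  rcases le_total (codegree G w) (codegree G u) with h | h
  · have h3 := hG.adj_of_codegree_le hux.1 (by omega) huw.1.symm hxw.symm
    exact (hG.adj_of_codegree_le h3 (by omega) hwy.1.symm hxy.symm).symm
  · have h3 := hG.adj_of_codegree_le hwy.1 (by omega) huw.1 hyu.symm
    exact hG.adj_of_codegree_le h3 (by omega) hux.1.symm hxy

end Greedy

/-! ### Total correctness of programs -/

@[simp] theorem State.reg_setReg (s : State) (r k q : ℕ) :
    (s.setReg r k).reg q = if q = r then k else s.reg q := by
  simp [State.setReg, Function.update_apply]

@[simp] theorem State.mem_setReg (s : State) (r k : ℕ) : (s.setReg r k).mem = s.mem := rfl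

@[simp] theorem State.reg_setMem (s : State) (a k : ℕ) : (s.setMem a k).reg = s.reg := rfl

@[simp] theorem State.mem_setMem (s : State) (a k : ℕ) :
    (s.setMem a k).mem = Function.update s.mem a k := rfl

/-- Started in `s`, the program `c` halts within `T` steps in a state that satisfies `Q`. -/
def Run (c : Cmd) (s : State) (T : ℕ) (Q : State → Prop) : Prop :=
  ∃ s' t, Exec c s s' t ∧ t ≤ T ∧ Q s'

namespace Run

variable {c d : Cmd} {s : State} {T U r k a b : ℕ} {Q Q' : State → Prop}

theorem skip (h : Q s) : Run .skip s 1 Q := ⟨_, _, .skip s, le_rfl, h⟩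

theorem const (h : Q (s.setReg r k)) : Run (.const r k) s 1 Q := ⟨_, _, .const r k s, le_rfl, h⟩

theorem add (h : Q (s.setReg r (s.reg a + s.reg b))) : Run (.add r a b) s 1 Q :=
  ⟨_, _, .add r a b s, le_rfl, h⟩

theorem sub (h : Q (s.setReg r (s.reg a - s.reg b))) : Run (.sub r a b) s 1 Q :=
  ⟨_, _, .sub r a b s, le_rfl, h⟩

theorem load (h : Q (s.setReg r (s.mem (s.reg a)))) : Run (.load r a) s 1 Q :=
  ⟨_, _, .load r a s, le_rfl, h⟩

theorem store (h : Q (s.setMem (s.reg a) (s.reg b))) : Run (.store a b) s 1 Q :=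
  ⟨_, _, .store a b s, le_rfl, h⟩

theorem seq (h : Run c s T fun s' => Run d s' U Q) : Run (.seq c d) s (T + U) Q := by
  obtain ⟨s', t, h1, h2, s'', u, h3, h4, h5⟩ := h
  exact ⟨s'', t + u, .seq h1 h3, add_le_add h2 h4, h5⟩

theorem ite (h1 : s.reg r ≠ 0 → Run c s T Q) (h2 : s.reg r = 0 → Run d s U Q) :
    Run (.ifNonzero r c d) s (T + U + 1) Q := by
  by_cases h : s.reg r = 0
  · obtain ⟨s', t, h3, h4, h5⟩ := h2 h
    exact ⟨s', t + 1, .ifFalse h h3, by omega, h5⟩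
  · obtain ⟨s', t, h3, h4, h5⟩ := h1 h
    exact ⟨s', t + 1, .ifTrue h h3, by omega, h5⟩

theorem mono (h : Run c s T Q) (hT : T ≤ U) (hQ : ∀ s', Q s' → Q' s') : Run c s U Q' := by
  obtain ⟨s', t, h1, h2, h3⟩ := h
  exact ⟨s', t, h1, h2.trans hT, hQ _ h3⟩

theorem le (h : Run c s T Q) (hT : T ≤ U) : Run c s U Q := h.mono hT fun _ => id

end Run

/-- Run `c` with the values `k - 1, …, 0` in register `i`, where `k` is its initial value. -/
def loop (i : ℕ) (c : Cmd) : Cmd := .whileNonzero i (.seq (.sub i i 1) c)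

/-- `I k` is the invariant when the counter is `k`. Each round pays for a test and a decrement
besides the body, and the last test costs one more step. The decrement subtracts register 1, which
must therefore hold 1. -/
theorem run_loop {i : ℕ} {c : Cmd} {N T : ℕ} (I : ℕ → State → Prop)
    (hstep : ∀ k s, k < N → I (k + 1) s → s.reg i = k + 1 → s.reg 1 = 1 ∧
      Run c (s.setReg i k) T fun s' => I k s' ∧ s'.reg i = k)
    {s : State} (hs : I N s) (hi : s.reg i = N) :
    Run (loop i c) s (N * (T + 2) + 1) (I 0) := by
  induction N generalizing s with
  | zero => exact ⟨s, 1, .whileStop hi, by omega, hs⟩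
  | succ N ih =>
    obtain ⟨h1, s', t, h2, h3, h4, h5⟩ := hstep N s (by omega) hs hi
    obtain ⟨s'', u, h6, h7, h8⟩ := ih (fun k s hk => hstep k s (by omega)) h4 h5
    refine ⟨s'', 1 + t + u + 1, .whileStep (by omega) (.seq (.sub i i 1 s) ?_) h6, ?_, h8⟩
    · rwa [hi, h1, Nat.add_sub_cancel]
    · rw [Nat.succ_mul]
      omega

/-- `R₈ := R_a * R₀ + R_b`, by repeated addition. -/
def address (a b : ℕ) : Cmd :=
  .seq (.add 8 b 2) (.seq (.add 15 a 2) (loop 15 (.add 8 8 0)))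

/-- The condition `a ≠ 8` is needed because `R₈` is written before `R_a` is copied to the counter.
The loop invariant describes the whole state, so nothing else changes. -/
theorem run_address {a b N : ℕ} {s : State} {Q : State → Prop} (h1 : s.reg 1 = 1)
    (h2 : s.reg 2 = 0) (hN : s.reg a = N) (ha : a ≠ 8)
    (hQ : Q ((s.setReg 8 (N * s.reg 0 + s.reg b)).setReg 15 0)) :
    Run (address a b) s (3 * N + 3) Q := by
  refine Run.mono (T := 1 + (1 + (N * (1 + 2) + 1))) (Q := Q) ?_ (by omega) fun _ => id
  refine .seq (.add (.seq (.add ?_)))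
  refine Run.mono (run_loop (fun k s' => k ≤ N ∧
    s' = (s.setReg 8 ((N - k) * s.reg 0 + s.reg b)).setReg 15 k) ?_ ?_ ?_) le_rfl ?_
  · rintro k _ hk ⟨-, rfl⟩ -
    refine ⟨by simpa using h1, .add ⟨⟨hk.le, ?_⟩, by simp⟩⟩
    have hk' : N - k = N - (k + 1) + 1 := by omega
    simp only [State.setReg, State.mk.injEq, and_true]
    funext q
    simp only [Function.update_apply]
    by_cases hq : q = 8
    · subst hq
      simp [hk', Nat.succ_mul]
      omega
    · by_cases hq' : q = 15 <;> simp [hq, hq']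
  · refine ⟨le_rfl, ?_⟩
    simp [ha, hN, h2]
  · simp [ha, hN, h2]
  · rintro _ ⟨-, rfl⟩
    simpa using hQ

/-- The constants kept in the first registers. -/
structure Env (n : ℕ) (s : State) : Prop where
  r0 : s.reg 0 = n
  r1 : s.reg 1 = 1
  r2 : s.reg 2 = 0
  r3 : s.reg 3 = n * n
  r4 : s.reg 4 = n + n

theorem Env.setReg {n : ℕ} {s : State} (h : Env n s) {r : ℕ} (hr : 5 ≤ r) (k : ℕ) :
    Env n (s.setReg r k) := by
  obtain ⟨h0, h1, h2, h3, h4⟩ := h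
  constructor <;> rw [State.reg_setReg, if_neg (by omega)] <;> assumption

theorem Env.setMem {n : ℕ} {s : State} (h : Env n s) (a k : ℕ) : Env n (s.setMem a k) :=
  ⟨h.r0, h.r1, h.r2, h.r3, h.r4⟩

theorem env_setReg_iff {n : ℕ} {s : State} {r : ℕ} (hr : 5 ≤ r) (k : ℕ) :
    Env n (s.setReg r k) ↔ Env n s := by
  have h : ∀ q, q < 5 → (s.setReg r k).reg q = s.reg q := fun q hq => by
    rw [State.reg_setReg, if_neg (by omega)]
  refine ⟨fun ⟨h0, h1, h2, h3, h4⟩ => ?_, fun h => h.setReg hr k⟩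
  rw [h _ (by decide)] at h0 h1 h2 h3 h4
  exact ⟨h0, h1, h2, h3, h4⟩

theorem env_setMem_iff {n : ℕ} {s : State} (a k : ℕ) : Env n (s.setMem a k) ↔ Env n s :=
  ⟨fun h => ⟨h.r0, h.r1, h.r2, h.r3, h.r4⟩, fun h => ⟨h.r0, h.r1, h.r2, h.r3, h.r4⟩⟩

/-- The memory holds the matrix `A`, row by row, followed by the vector `C`. -/
def Holds {n : ℕ} (μ : ℕ → ℕ) (A : Fin n → Fin n → ℕ) (C : Fin n → ℕ) : Prop :=
  (∀ i j : Fin n, μ (i * n + j) = A i j) ∧ ∀ i : Fin n, μ (n * n + i) = C i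

namespace Holds

variable {n : ℕ} {μ : ℕ → ℕ} {A : Fin n → Fin n → ℕ} {C : Fin n → ℕ}

theorem cell_lt (i j : Fin n) : (i : ℕ) * n + j < n * n := by
  have h1 : ((i : ℕ) + 1) * n ≤ n * n := Nat.mul_le_mul_right n i.2
  have h2 := j.2
  rw [Nat.succ_mul] at h1
  omega

theorem cell_inj {i j a b : Fin n} (h : (i : ℕ) * n + j = a * n + b) : i = a ∧ j = b := by
  have hn : 0 < n := i.pos
  have h1 := congrArg (· / n) h
  have h2 := congrArg (· % n) h
  simp only [Nat.mul_add_mod_of_lt, j.2, b.2] at h2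
  simp only [Nat.mul_comm _ n, Nat.mul_add_div hn, Nat.div_eq_of_lt j.2, Nat.div_eq_of_lt b.2] at h1
  exact ⟨Fin.ext h1, Fin.ext h2⟩

theorem update_cell (h : Holds μ A C) (i j : Fin n) (x : ℕ) :
    Holds (Function.update μ (i * n + j) x) (fun a b => if a = i ∧ b = j then x else A a b) C := by
  refine ⟨fun a b => ?_, fun a => ?_⟩
  · rw [Function.update_apply, h.1]
    refine if_congr ⟨cell_inj, ?_⟩ rfl rfl
    rintro ⟨rfl, rfl⟩
    rfl
  · have := cell_lt i j
    rw [Function.update_of_ne (by omega), h.2]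

theorem update_vector (h : Holds μ A C) (i : Fin n) (x : ℕ) :
    Holds (Function.update μ (n * n + i) x) A (Function.update C i x) := by
  refine ⟨fun a b => ?_, fun a => ?_⟩
  · have := cell_lt a b
    rw [Function.update_of_ne (by omega), h.1]
  · rw [Function.update_apply, Function.update_apply, h.2]
    refine if_congr ?_ rfl rfl
    rw [Fin.ext_iff]
    omega

end Holds

/-! ### The program -/

open Classical in
/-- The `0`-`1` matrix of a relation. -/
noncomputable def indicator {n : ℕ} (R : Fin n → Fin n → Prop) (a b : Fin n) : ℕ :=
  if R a b then 1 else 0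

theorem indicator_congr {n : ℕ} {R R' : Fin n → Fin n → Prop} {a b : Fin n}
    (h : R a b ↔ R' a b) : indicator R a b = indicator R' a b := by
  classical exact if_congr h rfl rfl

/-- Set up the constants. -/
def setConstants : Cmd :=
  .seq (.const 1 1) (.seq (.add 4 0 0) (.seq (address 0 2) (.add 3 8 2)))

/-- `R₁₀ :=` the codegree of vertex `R₇`. -/
def rowCodegree : Cmd :=
  .seq (.const 10 0) (.seq (.add 9 0 2)
    (loop 9 (.seq (address 7 9) (.seq (.load 11 8) (.seq (.add 10 10 1) (.sub 10 10 11))))))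

/-- Store all codegrees and let `R₅` be a vertex of codegree one. -/
def codegrees : Cmd :=
  .seq (.add 7 0 2) (loop 7 (.seq rowCodegree (.seq (.add 8 3 7) (.seq (.store 8 10)
    (.seq (.sub 12 10 1) (.ifNonzero 12 .skip (.add 5 7 2)))))))

/-- Delete the edges at vertex `R₅` and mark this vertex. -/
def isolateVertex : Cmd :=
  .seq (.seq (.add 7 0 2) (loop 7 (.seq (address 5 7) (.seq (.store 8 2)
    (.seq (address 7 5) (.store 8 2)))))) (.seq (.add 8 3 5) (.store 8 4))

/-- For `i = R₇` and `j = R₉`, read the entry at `i` and `j` of the matrix into `R₁₀`, compute the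
addresses of the codegrees of `i` and `j` in `R₁₁` and `R₁₃`, and the distance between the sum of
these codegrees and `R₆` in `R₁₂`. -/
def readPair : Cmd :=
  .seq (address 7 9) (.seq (.load 10 8) (.seq (.add 11 3 7) (.seq (.load 12 11)
    (.seq (.add 13 3 9) (.seq (.load 14 13) (.seq (.add 12 12 14) (.seq (.sub 14 12 6)
    (.seq (.sub 12 6 12) (.add 12 12 14)))))))))

/-- If `R₇` and `R₉` are adjacent and have `R₆` as the sum of their codegrees, then delete the edge
between them and mark both. -/
def matchPair : Cmd :=
  .seq readPair (.ifNonzero 10 (.ifNonzero 12 .skip (.seq (address 7 9) (.seq (.store 8 2)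
    (.seq (address 9 7) (.seq (.store 8 2) (.seq (.store 11 4) (.store 13 4))))))) .skip)

/-- Match greedily, by descending sums of codegrees. -/
def greedy : Cmd :=
  .seq (.add 6 4 2) (loop 6 (.seq (.add 7 0 2) (loop 7 (.seq (.add 9 0 2) (loop 9 matchPair)))))

/-- The program that computes a minimum deletion to cacti. -/
def deletionProgram : Cmd :=
  .seq setConstants (.seq codegrees (.seq isolateVertex greedy))

/-! ### Correctness and running time of the program -/

section Correctness

variable {n : ℕ} {G : SimpleGraph (Fin n)} {s : State}

theorem run_setConstants (G : SimpleGraph (Fin n)) :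
    Run setConstants (inputState G) (3 * n + 6) fun s' =>
      Env n s' ∧ s'.mem = (inputState G).mem := by
  refine .le (.seq (.const (.seq (.add (.seq (run_address (N := n) ?_ ?_ ?_ (by decide)
    (.add ?_))))))) (by omega)
  · simp [inputState]
  · simp [inputState]
  · simp [inputState]
  · refine ⟨⟨?_, ?_, ?_, ?_, ?_⟩, ?_⟩ <;> simp [inputState]

theorem holds_inputState (G : SimpleGraph (Fin n)) :
    ∃ C, Holds (inputState G).mem (indicator G.Adj) C := by
  classical
  refine ⟨fun i => (inputState G).mem (n * n + i), fun i j => ?_, fun _ => rfl⟩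
  refine if_congr ⟨?_, fun h => ⟨i, j, h, rfl⟩⟩ rfl rfl
  rintro ⟨a, b, h, he⟩
  obtain ⟨rfl, rfl⟩ := Holds.cell_inj he
  exact h

open Classical in
theorem run_rowCodegree {C : Fin n → ℕ} (he : Env n s) (hm : Holds s.mem (indicator G.Adj) C)
    (i : Fin n) (hi : s.reg 7 = i) :
    Run rowCodegree s (n * (3 * n + 8) + 3) fun s' =>
      Env n s' ∧ s'.mem = s.mem ∧ s'.reg 7 = i ∧ s'.reg 5 = s.reg 5 ∧
        s'.reg 10 = codegree G i := by
  refine .le (.seq (.const (.seq (.add (?_ : Run _ _ (n * (3 * n + 8) + 1) _))))) (by omega)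
  refine .mono (run_loop (T := 3 * n + 6) (fun k s' => Env n s' ∧ s'.mem = s.mem ∧ s'.reg 7 = i ∧
    s'.reg 5 = s.reg 5 ∧ s'.reg 10 =
      (Finset.univ.filter fun b : Fin n => k ≤ b ∧ ¬ G.Adj i b).card) ?_ ?_ ?_) le_rfl ?_
  · rintro k s₁ hk ⟨he₁, hm₁, h7, h5, h10⟩ h9
    refine ⟨he₁.r1, ?_⟩
    have hi' := i.2
    refine .le (.seq (run_address (N := i) ?_ ?_ ?_ (by decide)
      (.seq (.load (.seq (.add (.sub ?_))))))) (by omega)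
    · simp [he₁.r1]
    · simp [he₁.r2]
    · simp [h7]
    · refine ⟨⟨?_, by simp [hm₁], by simp [h7], by simp [h5], ?_⟩, by simp⟩
      · exact ((((((he₁.setReg (by decide) _).setReg (by decide) _).setReg (by decide) _).setReg
          (by decide) _).setReg (by decide) _).setReg (by decide) _)
      · have hcell := hm.1 i ⟨k, hk⟩
        simp only at hcell
        simp [hm₁, he₁.r0, he₁.r1, h10, hcell, indicator]
        -- The increment precedes the subtraction of the matrix entry, so the subtraction is never
        -- truncated.
        by_cases hadj : G.Adj i ⟨k, hk⟩
        · rw [if_pos hadj, Nat.add_sub_cancel]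
          congr 1
          ext b
          simp only [Finset.mem_filter, Finset.mem_univ, true_and]
          refine and_congr_left fun hb => ⟨fun h => by omega, fun h => ?_⟩
          have : (b : ℕ) ≠ k := fun h => hb (by rwa [show b = ⟨k, hk⟩ from Fin.ext h])
          omega
        · rw [if_neg hadj, Nat.sub_zero, ← Finset.card_insert_of_notMem (a := ⟨k, hk⟩) (by simp)]
          congr 1
          ext b
          simp only [Finset.mem_filter, Finset.mem_univ, true_and, Finset.mem_insert]
          constructor
          · rintro (rfl | h)
            · exact ⟨le_rfl, hadj⟩
            · exact ⟨by omega, h.2⟩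
          · rintro ⟨h1, h2⟩
            rcases h1.eq_or_lt with h | h
            · exact Or.inl (Fin.ext h.symm)
            · exact Or.inr ⟨h, h2⟩
  · refine ⟨(he.setReg (by decide) _).setReg (by decide) _, by simp, by simp [hi], by simp, ?_⟩
    simp only [State.reg_setReg]
    refine (Finset.card_eq_zero.2 ?_).symm
    ext b
    simp
  · simp [he.r0, he.r2]
  · rintro s' ⟨h1, h2, h3, h4, h5⟩
    exact ⟨h1, h2, h3, h4, by simpa [codegree] using h5⟩

theorem run_codegrees {C : Fin n → ℕ} (he : Env n s) (hm : Holds s.mem (indicator G.Adj) C) :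
    Run codegrees s (n * (n * (3 * n + 8) + 11) + 2) fun s' =>
      Env n s' ∧ Holds s'.mem (indicator G.Adj) (codegree G) ∧
        ((∃ a, codegree G a = 1) → ∃ a : Fin n, codegree G a = 1 ∧ s'.reg 5 = a) := by
  refine .le (.seq (.add (?_ : Run _ _ (n * (n * (3 * n + 8) + 11) + 1) _))) (by omega)
  -- The counter descends, so at value `k` exactly the vertices from `k` on have been treated.
  refine .mono (run_loop (T := n * (3 * n + 8) + 9) (fun k s' => Env n s' ∧
    ∃ C', Holds s'.mem (indicator G.Adj) C' ∧
    (∀ a : Fin n, k ≤ a → C' a = codegree G a) ∧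
    ((∃ a : Fin n, k ≤ a ∧ codegree G a = 1) → ∃ a : Fin n, codegree G a = 1 ∧ s'.reg 5 = a))
    ?_ ?_ ?_) le_rfl ?_
  · rintro k s₁ hk ⟨he₁, C', hm₁, hC', h5⟩ h7
    refine ⟨he₁.r1, .le (.seq (.mono (run_rowCodegree (he₁.setReg (r := 7) (by decide) k) hm₁
      ⟨k, hk⟩ (by simp)) le_rfl (?_ : ∀ s₂, _ → Run _ s₂ 6 _))) (by omega)⟩
    rintro s₂ ⟨he₂, hm₂, h7₂, h5₂, h10₂⟩
    simp only [State.mem_setReg, State.reg_setReg] at hm₂ h5₂ h7₂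
    have hstored : Holds (Function.update s₂.mem (n * n + k) (codegree G ⟨k, hk⟩))
        (indicator G.Adj) (Function.update C' ⟨k, hk⟩ (codegree G ⟨k, hk⟩)) := by
      rw [hm₂]
      exact hm₁.update_vector ⟨k, hk⟩ _
    have hC'' : ∀ a : Fin n, k ≤ a →
        Function.update C' ⟨k, hk⟩ (codegree G ⟨k, hk⟩) a = codegree G a := by
      intro a ha
      by_cases hak : a = ⟨k, hk⟩
      · subst hak
        simp
      · rw [Function.update_of_ne hak]
        refine hC' a ?_
        have : (a : ℕ) ≠ k := fun h => hak (Fin.ext h)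
        omega
    -- The test for `codegree - 1 = 0` with truncated subtraction detects codegree one only because
    -- codegrees are positive.
    have hpos := codegree_pos (G := G) (⟨k, hk⟩ : Fin n)
    refine .le (.seq (.add (.seq (.store (.seq (.sub (.ite (fun h => .skip ?_)
      fun h => .add ?_))))))) (by omega)
    · refine ⟨⟨((he₂.setReg (by decide) _).setMem _ _).setReg (by decide) _, _,
        by simpa [he₂.r3, h7₂, h10₂] using hstored, hC'', ?_⟩, by simp [h7₂]⟩
      rintro ⟨a, hka, ha⟩
      have hne : (a : ℕ) ≠ k := by
        intro h'
        have : a = ⟨k, hk⟩ := Fin.ext h'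
        subst this
        simp [h10₂, he₂.r1, ha] at h
      obtain ⟨b, hb, hb'⟩ := h5 ⟨a, by omega, ha⟩
      exact ⟨b, hb, by simpa [h5₂] using hb'⟩
    · refine ⟨⟨(((he₂.setReg (by decide) _).setMem _ _).setReg (by decide) _).setReg (by decide) _,
        _, by simpa [he₂.r3, h7₂, h10₂] using hstored, hC'', ?_⟩, by simp [h7₂]⟩
      rintro -
      refine ⟨⟨k, hk⟩, ?_, by simp [h7₂, he₂.r2]⟩
      simp [h10₂, he₂.r1] at h
      omega
  · refine ⟨he.setReg (by decide) _, C, hm, fun a ha => absurd a.2 (by omega), ?_⟩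
    rintro ⟨a, ha, -⟩
    exact absurd a.2 (by omega)
  · simp [he.r0, he.r2]
  · rintro s' ⟨h1, C', h2, h3, h4⟩
    have : C' = codegree G := funext fun a => h3 a (Nat.zero_le _)
    subst this
    exact ⟨h1, h2, fun ⟨a, ha⟩ => h4 ⟨a, Nat.zero_le _, ha⟩⟩

theorem run_isolateVertex (he : Env n s) (hm : Holds s.mem (indicator G.Adj) (codegree G))
    (v : Fin n) (hv : s.reg 5 = v) :
    Run isolateVertex s (n * (6 * n + 10) + 4) fun s' =>
      Env n s' ∧ Holds s'.mem (indicator (isolate G v).Adj)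
        (Function.update (codegree G) v (n + n)) := by
  refine .le (.seq (U := 2) (.seq (.add (?_ : Run _ _ (n * (6 * n + 10) + 1) _)))) (by omega)
  -- At counter `k`, the edges from `v` to vertices from `k` on have been erased.
  refine .mono (run_loop (T := 6 * n + 8) (fun k s' => Env n s' ∧ s'.reg 5 = v ∧
    ∃ A, Holds s'.mem A (codegree G) ∧ ∀ a b : Fin n, A a b =
      indicator (fun a b => G.Adj a b ∧ (a = v → (b : ℕ) < k) ∧ (b = v → (a : ℕ) < k)) a b)
    ?_ ?_ ?_) le_rfl ?_
  · rintro k s₁ hk ⟨he₁, h5, A, hm₁, hA⟩ h7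
    have hv' := v.2
    refine ⟨he₁.r1, .le (.seq (run_address (N := v) ?_ ?_ ?_ (by decide) (.seq (.store
      (.seq (run_address (N := k) ?_ ?_ ?_ (by decide) (.store ?_))))))) (by omega)⟩
    · simp [he₁.r1]
    · simp [he₁.r2]
    · simp [h5]
    · simp [he₁.r1]
    · simp [he₁.r2]
    · simp
    · refine ⟨⟨?_, by simp [h5],
        fun a b => if a = ⟨k, hk⟩ ∧ b = v then 0 else if a = v ∧ b = ⟨k, hk⟩ then 0 else A a b,
        ?_, ?_⟩, by simp⟩
      · exact ((((((he₁.setReg (by decide) _).setReg (by decide) _).setReg (by decide) _).setMem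
          _ _).setReg (by decide) _).setReg (by decide) _).setMem _ _
      · simpa [he₁.r0, he₁.r2, h5] using
          (hm₁.update_cell v ⟨k, hk⟩ 0).update_cell ⟨k, hk⟩ v 0
      · intro a b
        by_cases hab : G.Adj a b <;>
          simp only [hA, indicator, Fin.ext_iff, hab, true_and, false_and, if_false, ite_self]
        split_ifs <;> omega
  · refine ⟨he.setReg (by decide) _, by simp [hv], _, hm, fun a b => ?_⟩
    exact indicator_congr (by simp)
  · simp [he.r0, he.r2]
  · rintro s' ⟨h1, h5, A, h2, hA⟩
    refine .le (.seq (.add (.store ⟨(h1.setReg (by decide) _).setMem _ _, ?_⟩))) le_rfl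
    have hAe : A = indicator (isolate G v).Adj := by
      funext a b
      rw [hA]
      exact indicator_congr (by simp [isolate])
    simpa [h1.r3, h1.r4, h5, hAe] using h2.update_vector v (n + n)

/-- The matrix of the graph that is left after removal of `v` and of the edges of a matching. -/
noncomputable def restMatrix (G : SimpleGraph (Fin n)) (v : Fin n) (m : Equiv.Perm (Fin n)) :
    Fin n → Fin n → ℕ :=
  indicator fun a b => (isolate G v).Adj a b ∧ m a ≠ b

/-- The codegrees, with marks for `v` and the vertices that a matching covers. -/
noncomputable def markedCodegree (G : SimpleGraph (Fin n)) (v : Fin n) (m : Equiv.Perm (Fin n))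
    (a : Fin n) : ℕ :=
  if a = v ∨ m a ≠ a then n + n else codegree G a

/-- The state of the greedy algorithm: some matching that extends to a maximum one is deleted from
the matrix, the vertices that it covers are marked, and among the others, adjacent ones have a sum
of codegrees below `k`, or equal to `k` with the pair in `R`. -/
def GreedyState (G : SimpleGraph (Fin n)) (v : Fin n) (k : ℕ) (R : Fin n → Fin n → Prop)
    (s : State) : Prop :=
  Env n s ∧ ∃ m, IsExtendable (isolate G v) m ∧
    Holds s.mem (restMatrix G v m) (markedCodegree G v m) ∧
    ∀ a b, (isolate G v).Adj a b → m a = a → m b = b →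
      codegree G a + codegree G b < k ∨ (codegree G a + codegree G b = k ∧ R a b)

theorem GreedyState.setReg {v : Fin n} {k : ℕ} {R : Fin n → Fin n → Prop}
    (h : GreedyState G v k R s) {r : ℕ} (hr : 5 ≤ r) (x : ℕ) :
    GreedyState G v k R (s.setReg r x) :=
  ⟨h.1.setReg hr x, h.2⟩

/-- Used at the boundaries of the loops: a sum below `k + 1` is one below `k`, or equal to `k` with
the pair still to be scanned. -/
theorem GreedyState.mono {v : Fin n} {k k' : ℕ} {R R' : Fin n → Fin n → Prop}
    (h : GreedyState G v k R s)
    (hR : ∀ a b x, x < k ∨ (x = k ∧ R a b) → x < k' ∨ (x = k' ∧ R' a b)) :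
    GreedyState G v k' R' s := by
  obtain ⟨h1, m, h2, h3, h4⟩ := h
  exact ⟨h1, m, h2, h3, fun a b h ha hb => hR _ _ _ (h4 a b h ha hb)⟩

theorem markedCodegree_of_adj {v : Fin n} {m : Equiv.Perm (Fin n)} {a b : Fin n}
    (hab : (isolate G v).Adj a b) (ha : m a = a) : markedCodegree G v m a = codegree G a :=
  if_neg (by simp [hab.2.1, ha])

theorem restMatrix_mul_swap {v i j : Fin n} {m : Equiv.Perm (Fin n)} (hi : m i = i) (hj : m j = j)
    (a b : Fin n) : restMatrix G v (m * Equiv.swap i j) a b =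
      if a = j ∧ b = i then 0 else if a = i ∧ b = j then 0 else restMatrix G v m a b := by
  by_cases hab : (isolate G v).Adj a b
  · have hne := hab.ne
    by_cases hai : a = i
    · subst hai
      by_cases hbj : b = j
      · subst hbj
        simp [restMatrix, indicator, hj]
      · simp [restMatrix, indicator, hab, hj, hi, hbj, hne, hne.symm, Ne.symm hbj]
    by_cases haj : a = j
    · subst haj
      by_cases hbi : b = i
      · subst hbi
        simp [restMatrix, indicator, hi]
      · simp [restMatrix, indicator, hab, hj, hi, hbi, hne, hai, Ne.symm hbi]
    · rw [if_neg fun h => haj h.1, if_neg fun h => hai h.1]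
      exact indicator_congr (by simp [Equiv.swap_apply_of_ne_of_ne hai haj])
  · simp [restMatrix, indicator, hab]

theorem markedCodegree_mul_swap {v i j : Fin n} {m : Equiv.Perm (Fin n)} (hi : m i = i)
    (hj : m j = j) (hij : i ≠ j) : markedCodegree G v (m * Equiv.swap i j) =
      Function.update (Function.update (markedCodegree G v m) i (n + n)) j (n + n) := by
  funext a
  by_cases haj : a = j
  · subst haj
    simp [markedCodegree, hi, hij]
  by_cases hai : a = i
  · subst hai
    simp [markedCodegree, hj, hij, hij.symm]
  · simp [markedCodegree, Equiv.swap_apply_of_ne_of_ne hai haj, hai, haj]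

theorem run_readPair {A : Fin n → Fin n → ℕ} {C : Fin n → ℕ} (he : Env n s) (hm : Holds s.mem A C)
    (i j : Fin n) (h7 : s.reg 7 = i) (h9 : s.reg 9 = j) :
    Run readPair s (3 * n + 12) fun s' => Env n s' ∧ s'.mem = s.mem ∧ s'.reg 6 = s.reg 6 ∧
      s'.reg 7 = i ∧ s'.reg 9 = j ∧ s'.reg 10 = A i j ∧ s'.reg 11 = n * n + i ∧
      s'.reg 13 = n * n + j ∧ (s'.reg 12 = 0 ↔ C i + C j = s.reg 6) := by
  have hi := i.2
  have hcell := hm.1 i j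
  have hci := hm.2 i
  have hcj := hm.2 j
  refine .le (.seq (run_address (N := i) ?_ ?_ ?_ (by decide)
    (.seq (.load (.seq (.add (.seq (.load (.seq (.add (.seq (.load (.seq (.add (.seq (.sub
    (.seq (.sub (.add ?_))))))))))))))))))) (by omega)
  · simp [he.r1]
  · simp [he.r2]
  · simp [h7]
  · refine ⟨?_, ?_, ?_, ?_, ?_, ?_, ?_, ?_, ?_⟩
    · simp [env_setReg_iff, he]
    all_goals simp [h7, h9, he.r0, he.r3, hcell, hci, hcj]
    omega

/-- `R` and `R'` are the pairs yet to be scanned before and after the visit to `(i, j)`. -/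
theorem run_matchPair (hG : IsQuasiThreshold G) {v i j : Fin n} {k : ℕ} (hk : k < n + n)
    {R R' : Fin n → Fin n → Prop} (hR : ∀ a b, R a b → R' a b ∨ (a = i ∧ b = j))
    (hs : GreedyState G v k R s) (h6 : s.reg 6 = k) (h7 : s.reg 7 = i) (h9 : s.reg 9 = j) :
    Run matchPair s (9 * n + 30) fun s' => GreedyState G v k R' s' ∧ s'.reg 6 = k ∧
      s'.reg 7 = i ∧ s'.reg 9 = j := by
  obtain ⟨he, m, hm, hh, hp⟩ := hs
  have hi := i.2
  have hj := j.2
  have hcell := hh.1 i j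
  have hci := hh.2 i
  have hcj := hh.2 j
  -- A failed test settles the pair: for adjacent unmatched vertices the entry is 1 and the stored
  -- values are the true codegrees.
  have hskip : restMatrix G v m i j = 0 ∨ markedCodegree G v m i + markedCodegree G v m j ≠ k →
      ∀ a b, (isolate G v).Adj a b → m a = a → m b = b →
        codegree G a + codegree G b < k ∨ (codegree G a + codegree G b = k ∧ R' a b) := by
    intro h a b hab ha hb
    rcases hp a b hab ha hb with h1 | ⟨h1, h2⟩
    · exact Or.inl h1
    rcases hR a b h2 with h3 | ⟨rfl, rfl⟩
    · exact Or.inr ⟨h1, h3⟩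
    rw [markedCodegree_of_adj hab ha, markedCodegree_of_adj hab.symm hb] at h
    rcases h with h | h
    · simp [restMatrix, indicator, hab, ha, hab.ne] at h
    · exact absurd h1 h
  refine .le (U := 9 * n + 30) (.seq (U := 6 * n + 15) (.mono (run_readPair he hh i j h7 h9) le_rfl
    ?_)) (by omega)
  rintro s' ⟨he', hm', h6', h7', h9', h10', h11', h13', h12'⟩
  rw [h6] at h6' h12'
  rw [← hm'] at hh
  refine .le (.ite (T := 6 * n + 12) (fun h10 => .le (.ite (fun h12 => .skip ?_)
    fun h12 => .seq (run_address (N := i) ?_ ?_ ?_ (by decide) (.seq (.store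
      (.seq (run_address (N := j) ?_ ?_ ?_ (by decide)
        (.seq (.store (.seq (.store (.store ?_))))))))))) (by omega)) fun h10 => .skip ?_) (by omega)
  · exact ⟨⟨he', m, hm, hh, hskip (Or.inr (mt h12'.2 h12))⟩, h6', h7', h9'⟩
  · simp [he'.r1]
  · simp [he'.r2]
  · simp [h7']
  · simp [he'.r1]
  · simp [he'.r2]
  · simp [h9']
  · rw [h10'] at h10
    have hk' := h12'.1 h12
    have hij : (isolate G v).Adj i j := by
      by_contra h
      simp [restMatrix, indicator, h] at h10
    -- A mark `n + n` alone exceeds `k`, so matched vertices never pass the test.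
    have hmi : m i = i := by
      by_contra h
      simp [markedCodegree, h] at hk'
      omega
    have hmj : m j = j := by
      by_contra h
      simp [markedCodegree, h] at hk'
      omega
    rw [markedCodegree_of_adj hij hmi, markedCodegree_of_adj hij.symm hmj] at hk'
    refine ⟨⟨?_, m * Equiv.swap i j, ?_, ?_, ?_⟩, by simp [h6'], by simp [h7'], by simp [h9']⟩
    · simp [env_setReg_iff, env_setMem_iff, he']
    -- By the invariant no adjacent unmatched pair has a sum above `k`, and this one attains `k`.
    · refine hm.mul_swap_of_codegree hG hij hmi hmj fun a b hab ha hb => ?_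
      rcases hp a b hab ha hb with h | h <;> omega
    · rw [markedCodegree_mul_swap hmi hmj hij.ne, funext₂ (restMatrix_mul_swap hmi hmj)]
      have := (((hh.update_cell i j 0).update_cell j i 0).update_vector i (n + n)).update_vector
        j (n + n)
      simpa [h7', h9', h11', h13', he'.r0, he'.r2, he'.r4] using this
    · intro a b hab ha hb
      have hfix : ∀ c, (m * Equiv.swap i j) c = c → m c = c ∧ c ≠ i ∧ c ≠ j := by
        intro c hc
        by_cases hci : c = i
        · subst hci
          simp [hmj, hij.ne.symm] at hc
        by_cases hcj : c = j
        · subst hcj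
          simp [hmi, hij.ne] at hc
        rw [Equiv.Perm.mul_apply, Equiv.swap_apply_of_ne_of_ne hci hcj] at hc
        exact ⟨hc, hci, hcj⟩
      rcases hp a b hab (hfix a ha).1 (hfix b hb).1 with h1 | ⟨h1, h2⟩
      · exact Or.inl h1
      · exact Or.inr ⟨h1, (hR a b h2).resolve_right fun h => (hfix a ha).2.1 h.1⟩
  · exact ⟨⟨he', m, hm, hh, hskip (Or.inl (h10'.symm.trans h10))⟩, h6', h7', h9'⟩

/-- At the end all adjacent unmatched pairs would have a sum below 0, so there are none; the
extendable matching is then maximum. -/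
theorem run_greedy (hG : IsQuasiThreshold G) (he : Env n s) (v : Fin n)
    (hm : Holds s.mem (indicator (isolate G v).Adj) (Function.update (codegree G) v (n + n))) :
    Run greedy s ((n + n) * (n * (n * (9 * n + 32) + 4) + 4) + 2) fun s' =>
      ∃ m, IsMaxPermMatching (isolate G v) m ∧
        Holds s'.mem (restMatrix G v m) (markedCodegree G v m) := by
  refine .le (.seq (.add
    (?_ : Run _ _ ((n + n) * (n * (n * (9 * n + 32) + 4) + 4) + 1) _))) (by omega)
  refine .mono (run_loop (T := n * (n * (9 * n + 32) + 4) + 2)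
    (fun k s' => GreedyState G v k (fun _ _ => False) s') ?_ ?_ ?_) le_rfl ?_
  · intro k s₁ hk h₁ _
    refine ⟨h₁.1.r1, .le (.seq (.add
      (?_ : Run _ _ (n * (n * (9 * n + 32) + 4) + 1) _))) (by omega)⟩
    refine .mono (run_loop (T := n * (9 * n + 32) + 2)
      (fun i s' => GreedyState G v k (fun a _ => (a : ℕ) < i) s' ∧ s'.reg 6 = k) ?_ ?_ ?_) le_rfl ?_
    · rintro i s₂ hi ⟨h₂, h6₂⟩ _
      refine ⟨h₂.1.r1, .le (.seq (.add
        (?_ : Run _ _ (n * (9 * n + 32) + 1) _))) (by omega)⟩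
      refine .mono (run_loop (T := 9 * n + 30)
        (fun j s' => GreedyState G v k (fun a b => (a : ℕ) < i ∨ ((a : ℕ) = i ∧ (b : ℕ) < j)) s' ∧
          s'.reg 6 = k ∧ s'.reg 7 = i) ?_ ?_ ?_) le_rfl ?_
      · rintro j s₃ hj ⟨h₃, h6₃, h7₃⟩ _
        refine ⟨h₃.1.r1, .mono (run_matchPair hG (i := ⟨i, hi⟩) (j := ⟨j, hj⟩) hk ?_
          (h₃.setReg (by decide) j) (by simp [h6₃]) (by simp [h7₃]) (by simp)) le_rfl
          fun _ h => ⟨⟨h.1, h.2.1, h.2.2.1⟩, h.2.2.2⟩⟩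
        intro a b hab
        simp only [Fin.ext_iff]
        omega
      · refine ⟨((h₂.setReg (by decide) _).setReg (by decide) _).mono fun a b x h => ?_,
          by simp [h6₂], by simp⟩
        have := b.2
        omega
      · simp [h₂.1.r0, h₂.1.r2]
      · rintro s' ⟨h1, h2, h3⟩
        exact ⟨⟨h1.mono fun a b x h => by omega, h2⟩, h3⟩
    · refine ⟨((h₁.setReg (by decide) _).setReg (by decide) _).mono fun a b x h => ?_, by simp⟩
      have := a.2
      simp only [and_false, or_false] at h
      omega
    · simp [h₁.1.r0, h₁.1.r2]
    · rintro s' ⟨h1, h2⟩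
      exact ⟨h1.mono fun a b x h => by omega, h2⟩
  · refine ⟨he.setReg (by decide) _, 1, isExtendable_one, ?_, fun a b hab _ _ => Or.inl ?_⟩
    · have h1 : restMatrix G v 1 = indicator (isolate G v).Adj := by
        funext a b
        refine indicator_congr ⟨fun h => h.1, fun h => ⟨h, h.ne⟩⟩
      have h2 : markedCodegree G v 1 = Function.update (codegree G) v (n + n) := by
        funext a
        rw [Function.update_apply]
        simp [markedCodegree]
      rw [h1, h2]
      exact hm
    · have h1 := codegree_lt_of_adj hab.1
      have h2 := codegree_lt_of_adj hab.1.symm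
      rw [Fintype.card_fin] at h1 h2
      omega
  · simp [he.r4, he.r2]
  · rintro s' ⟨-, m, hm, hh, hp⟩
    refine ⟨m, hm.isMaxPermMatching fun a b hab ha hb => ?_, hh⟩
    rcases hp a b hab ha hb with h | h
    · exact absurd h (by omega)
    · exact h.2

theorem run_deletionProgram (hG : IsQuasiThreshold G) (hc : G.Connected) :
    Run deletionProgram (inputState G)
      ((3 * n + 6) + ((n * (n * (3 * n + 8) + 11) + 2) + ((n * (6 * n + 10) + 4) +
        ((n + n) * (n * (n * (9 * n + 32) + 4) + 4) + 2)))) fun s' =>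
      ∃ v m, G.IsUniversal v ∧ IsMaxPermMatching (isolate G v) m ∧
        Holds s'.mem (restMatrix G v m) (markedCodegree G v m) := by
  obtain ⟨C, hC⟩ := holds_inputState G
  refine .seq (.mono (run_setConstants G) le_rfl ?_)
  rintro s₁ ⟨he₁, hm₁⟩
  rw [← hm₁] at hC
  refine .seq (.mono (run_codegrees he₁ hC) le_rfl ?_)
  rintro s₂ ⟨he₂, hm₂, hv⟩
  obtain ⟨u, hu⟩ := hG.exists_isUniversal hc
  obtain ⟨v, hv, h5⟩ := hv ⟨u, codegree_eq_one_iff.2 hu⟩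
  refine .seq (.mono (run_isolateVertex he₂ hm₂ v h5) le_rfl ?_)
  rintro s₃ ⟨he₃, hm₃⟩
  refine .mono (run_greedy hG he₃ v hm₃) le_rfl ?_
  rintro s₄ ⟨m, hm⟩
  exact ⟨v, m, codegree_eq_one_iff.1 hv, hm⟩

/-- The program erases just the edges that the cactus keeps, so the remaining matrix is the output
in place. -/
theorem holdsOutput_of_holds {v : Fin n} {m : Equiv.Perm (Fin n)}
    (hm : IsPermMatching (isolate G v) m) {C : Fin n → ℕ} (h : Holds s.mem (restMatrix G v m) C) :
    HoldsOutput s (G.edgeSet \ (starPlus v (permSubgraph hm)).edgeSet) := by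
  intro i j
  rw [h.1, restMatrix, indicator]
  congr 1
  rw [eq_iff_iff, Set.mem_sdiff, SimpleGraph.mem_edgeSet, SimpleGraph.mem_edgeSet,
    starPlus_permSubgraph_adj]
  constructor
  · rintro ⟨⟨h1, h2, h3⟩, h4⟩
    exact ⟨h1, fun ⟨_, h5⟩ => by tauto⟩
  · rintro ⟨h1, h2⟩
    have h3 : ¬ (i = v ∨ j = v ∨ m i = j) := fun h => h2 ⟨h1.ne, h⟩
    exact ⟨⟨h1, by tauto, by tauto⟩, by tauto⟩

end Correctness

end CactusDeletion

theorem mainTheorem7 :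
    (∀ (V : Type*) [Finite V] (G : SimpleGraph V),
      G.Connected → CactusDeletion.IsQuasiThreshold G →
        (∃ v, G.IsUniversal v) ∧
        ∀ v, G.IsUniversal v →
          CactusDeletion.IsQuasiThreshold (CactusDeletion.minus G v) ∧
          (∃ H : SimpleGraph V, CactusDeletion.IsMaxSpanningCactus G H ∧
            ∀ (u : V) (p : H.Walk u u), p.IsCycle → p.length = 3 ∧ v ∈ p.support) ∧
          ∀ M : (CactusDeletion.minus G v).Subgraph, CactusDeletion.IsMaxMatching M →
            CactusDeletion.IsMaxSpanningCactus G (CactusDeletion.starPlus v M) ∧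
            CactusDeletion.IsMinCactusDeletion G
              (G.edgeSet \ (CactusDeletion.starPlus v M).edgeSet)) ∧
    CactusDeletion.EdgeSetComputableInPolyTime
      (fun _ G => G.Connected ∧ CactusDeletion.IsQuasiThreshold G)
      (fun n G F => CactusDeletion.IsMinCactusDeletion G F ∧
        ∃ (v : Fin n) (M : (CactusDeletion.minus G v).Subgraph),
          G.IsUniversal v ∧ CactusDeletion.IsMaxMatching M ∧
            F = G.edgeSet \ (CactusDeletion.starPlus v M).edgeSet) := by
  refine ⟨fun V _ G hc hG => ⟨hG.exists_isUniversal hc, fun v hv => ⟨hG.minus v, ?_, fun M hM => ?_⟩⟩,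
    ?_⟩
  · obtain ⟨M, hM⟩ := CactusDeletion.exists_isMaxMatching (CactusDeletion.minus G v)
    exact ⟨_, CactusDeletion.starPlus_isMaxSpanningCactus hv hM, fun u p hp =>
      ⟨(CactusDeletion.mem_edges_of_isCycle_starPlus hM.1 hp).1,
        CactusDeletion.mem_support_of_isCycle_starPlus hM.1 hp⟩⟩
  · have h := CactusDeletion.starPlus_isMaxSpanningCactus hv hM
    exact ⟨h, h.isMinCactusDeletion⟩
  -- The polynomial copies the time bound of `run_deletionProgram` term by term.
  · refine ⟨CactusDeletion.deletionProgram, (3 * .X + 6) + ((.X * (.X * (3 * .X + 8) + 11) + 2) +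
      ((.X * (6 * .X + 10) + 4) + ((.X + .X) * (.X * (.X * (9 * .X + 32) + 4) + 4) + 2))), ?_⟩
    rintro n G ⟨hc, hG⟩
    obtain ⟨s, t, hrun, ht, v, m, hv, hm, hh⟩ := CactusDeletion.run_deletionProgram hG hc
    have hM := CactusDeletion.permSubgraph_isMaxMatching hm
    exact ⟨s, t, _, hrun, by simpa using ht, CactusDeletion.holdsOutput_of_holds hm.1 hh,
      (CactusDeletion.starPlus_isMaxSpanningCactus hv hM).isMinCactusDeletion, v, _, hv, hM, rfl⟩
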